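/- Setting. For each $n$ we observe $(y_i,x_i,w_i)\in\mathbb R\times\mathbb R^{p}\times\mathbb R$, $i=1,\dots,n$, from the change point regression model $$y_i=x_i^T\beta_0\mathbf 1[w_i\le\tau_0]+x_i^T\gamma_0\mathbf 1[w_i>\tau_0]+\varepsilon_i ,$$ where $p=p_n$, $\beta_0,\gamma_0\in\mathbb R^{p}$, $\tau_0\in\mathbb R\cup\{-\infty\}$ and the distributions may all depend on $n$. Assume: * (sparsity) the set $S=\{j:\beta_{0j}\neq0\text{ or }\gamma_{0j}\ne0\}$ satisfies $|S|\le s$ for an integer $s=s_n\ge1$, and $s\log p/n\to0$; * the $x_i$ are i.i.d. with mean zero and $E\exp(t\,x_i^Tv)\le\exp(\sigma_x^2t^2/2)$ for all $t\in\mathbb R$ and all $v$ with $\|v\|_2=1$, and all eigenvalues of $\Sigma=Ex_ix_i^T$ lie in $[\kappa,\phi]$, $\kappa>0$; the $\varepsilon_i$ are i.i.d. with mean zero and $E\exp(t\varepsilon_i)\le\exp(\sigma_\varepsilon^2t^2/2)$ for all $t$; the $w_i$ are i.i.d. with cdf $\Phi$ (set $\Phi(-\infty)=0$); the variables $x_i,w_i,\varepsilon_i$,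 $i=1,\dots,n$, are mutually independent. Here $\sigma_x,\sigma_\varepsilon,\kappa,\phi$ do not depend on $n$. Put $\Phi_{\min}(\tau)=\min\{\Phi(\tau),1-\Phi(\tau)\}$, $\xi_n=\|\beta_0-\gamma_0\|_2$, and for $\tau\in\mathbb R$ let $\hat\beta(\tau)$ and $\hat\gamma(\tau)$ be any solutions of $$\min_{\beta\in\mathbb R^p}\frac1n\sum_{i:\,w_i\le\tau}(y_i-x_i^T\beta)^2+\lambda_1\|\beta\|_1,\qquad \min_{\gamma\in\mathbb R^p}\frac1n\sum_{i:\,w_i>\tau}(y_i-x_i^T\gamma)^2+\lambda_1\|\gamma\|_1 .$$ **(i) No change.** There are constants $C_0,c_1,c_2>0$, depending only on $\sigma_x,\sigma_\varepsilon,\kappa,\phi$, such that for every $C_1\ge C_0$ there is $K>0$, depending only on these parameters and $C_1$, with the following property. If $\Phi(\tau_0)=0$, if $\tau=\tau_n\in\mathbb R$ satisfies $\Phi_{\min}(\tau)>0$ and $\Phi_{\min}(\tau)^{-1}s\log p/n\to0$, and if $C_0\sqrt{\log p/n}\le\lambda_1\le C_1\sqrt{\log p/n}$, then for all sufficiently large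 $n$, with probability at least $1-c_1\exp(-c_2\log p)$, for $q=1,2$, $$\|\hat\beta(\tau)-\gamma_0\|_q\le K\,\Phi_{\min}(\tau)^{-1}s^{1/q}\sqrt{\frac{\log p}{n}},\qquad \|\hat\gamma(\tau)-\gamma_0\|_q\le K\,\Phi_{\min}(\tau)^{-1}s^{1/q}\sqrt{\frac{\log p}{n}} .$$ **(ii) A finite change point.** For every $L>0$ there are constants $C_0,c_1,c_2>0$, depending only on $\sigma_x,\sigma_\varepsilon,\kappa,\phi,L$, such that for every $C\ge C_0$ there is $K>0$, depending only on these parameters and $C$, with the following property. Suppose $\Phi_{\min}(\tau_0)>0$ and $\Phi_{\min}(\tau_0)^{-1}s\log p/n\to0$, let $u_n\ge0$ satisfy $u_n=o(\Phi_{\min}(\tau_0))$, and suppose that for each $n$ either $u_n=0$, or $\log p/n\le L\,u_n$, or $\xi_n\sqrt{\log p/n}\le L$. Let $\lambda_1=C\max\{\sqrt{\log p/n},\,\xi_nu_n\}$ and $\mathcal T(\tau_0,u_n)=\{\tau\in\mathbb R:|\Phi(\tau)-\Phi(\tau_0)|\le u_n\}$. Then for all sufficiently large $n$, with probability at least $1-c_1\exp(-c_2\log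 p)$, for $q=1,2$, $$\sup_{\tau\in\mathcal T(\tau_0,u_n)}\|\hat\beta(\tau)-\beta_0\|_q\le K\,\Phi_{\min}(\tau_0)^{-1}s^{1/q}\max\Big\{\sqrt{\frac{\log p}{n}},\,\xi_nu_n\Big\},$$ and the same bound holds for $\sup_{\tau\in\mathcal T(\tau_0,u_n)}\|\hat\gamma(\tau)-\gamma_0\|_q$. -/

import Mathlib

open MeasureTheory ProbabilityTheory Filter Topology
open scoped NNReal ENNReal Matrix

universe u

noncomputable section

/-- The `ℓ_q` norm `(∑ |v_j|^q)^{1/q}` on `ℝ^p` (used for `q = 1, 2`). -/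
def lqNorm {p : ℕ} (q : ℕ) (v : Fin p → ℝ) : ℝ :=
  (∑ j, |v j| ^ q) ^ (1 / (q : ℝ))

/-- The random variables and the parameters of a change point regression model with `n`
observations and `p` predictors, on a probability space `(Ω, P)`. The change point `τ₀` lives in
`ℝ ∪ {-∞}`. The response is not a field, it is defined by the model equation below. -/
structure ChangePointModel (n p : ℕ) where
  /-- sample space -/
  Ω : Type u
  [mΩ : MeasurableSpace Ω]
  /-- underlying probability measure -/
  P : Measure Ω
  [isProb : IsProbabilityMeasure P]
  /-- predictors -/
  x : Fin n → Ω → (Fin p → ℝ)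
  /-- change inducing variables -/
  w : Fin n → Ω → ℝ
  /-- errors -/
  ε : Fin n → Ω → ℝ
  measurable_x : ∀ i, Measurable (x i)
  measurable_w : ∀ i, Measurable (w i)
  measurable_ε : ∀ i, Measurable (ε i)
  /-- the common law of the `w i` -/
  lawW : Measure ℝ
  [isProbW : IsProbabilityMeasure lawW]
  /-- regression vector before the change -/
  β₀ : Fin p → ℝ
  /-- regression vector after the change -/
  γ₀ : Fin p → ℝ
  /-- change point, `⊥ = -∞` meaning that there is no change -/
  τ₀ : WithBot ℝ

attribute [instance] ChangePointModel.mΩ ChangePointModel.isProb ChangePointModel.isProbW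

namespace ChangePointModel

variable {n p : ℕ} (M : ChangePointModel.{u} n p)

/-- `y_i = x_iᵀβ₀ 1[w_i ≤ τ₀] + x_iᵀγ₀ 1[w_i > τ₀] + ε_i`. -/
def y (i : Fin n) (ω : M.Ω) : ℝ :=
  (if ((M.w i ω : ℝ) : WithBot ℝ) ≤ M.τ₀ then M.x i ω ⬝ᵥ M.β₀ else M.x i ω ⬝ᵥ M.γ₀) + M.ε i ω

/-- The distribution function of `w` on `ℝ ∪ {-∞}`, with `Φ(-∞) = 0`. -/
def Φ : WithBot ℝ → ℝ :=
  WithBot.recBotCoe 0 (fun a : ℝ => cdf M.lawW a)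

/-- `Φ_min(τ) = min {Φ(τ), 1 - Φ(τ)}`. -/
def Φmin (τ : WithBot ℝ) : ℝ := min (M.Φ τ) (1 - M.Φ τ)

/-- The jump size `ξ = ‖β₀ - γ₀‖₂`. -/
def ξ : ℝ := lqNorm 2 (M.β₀ - M.γ₀)

/-- The second moment matrix `E[x_i x_iᵀ]`; it is the covariance matrix, as `x_i` is centered. -/
def covX (i : Fin n) : Matrix (Fin p) (Fin p) ℝ :=
  Matrix.of fun j k => ∫ ω, M.x i ω j * M.x i ω k ∂M.P

/-- Sparsity: the union `S` of the supports of `β₀` and `γ₀` has at most `s` elements, `s ≥ 1`. -/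
def Sparse (s : ℕ) : Prop :=
  1 ≤ s ∧ {j | M.β₀ j ≠ 0 ∨ M.γ₀ j ≠ 0}.ncard ≤ s

/-- The distributional assumptions. Here `HasSubgaussianMGF X c P` says that `exp (t X)` is
integrable and `E[exp (t X)] ≤ exp (c t² / 2)` for all real `t`. -/
structure Distribution (σx σε : ℝ≥0) (κ φ : ℝ) : Prop where
  /-- the `x_i` are identically distributed -/
  x_ident : ∀ i i', IdentDistrib (M.x i) (M.x i') M.P M.P
  /-- the `x_i` have mean zero -/
  x_mean : ∀ i j, ∫ ω, M.x i ω j ∂M.P = 0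
  /-- the `x_i` are subgaussian vectors -/
  x_subgaussian : ∀ i (v : Fin p → ℝ), lqNorm 2 v = 1 →
    HasSubgaussianMGF (fun ω => M.x i ω ⬝ᵥ v) (σx ^ 2) M.P
  /-- the eigenvalues of the covariance matrix lie in `[κ, φ]` -/
  x_eigenvalue : ∀ i (a : ℝ),
    Module.End.HasEigenvalue (Matrix.toLin' (M.covX i)) a → κ ≤ a ∧ a ≤ φ
  /-- the `ε_i` are identically distributed -/
  ε_ident : ∀ i i', IdentDistrib (M.ε i) (M.ε i') M.P M.P
  /-- the `ε_i` have mean zero -/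
  ε_mean : ∀ i, ∫ ω, M.ε i ω ∂M.P = 0
  /-- the `ε_i` are subgaussian -/
  ε_subgaussian : ∀ i, HasSubgaussianMGF (M.ε i) (σε ^ 2) M.P
  /-- the `w_i` have the common law `lawW`, hence the distribution function `Φ` -/
  w_law : ∀ i, M.P.map (M.w i) = M.lawW
  /-- the observations `(x_i, w_i, ε_i)` are independent over `i` -/
  indep_obs : iIndepFun (fun i ω => (M.x i ω, M.w i ω, M.ε i ω)) M.P
  /-- for each `i`, the variables `x_i`, `w_i`, `ε_i` are (mutually) independent -/
  indep_x : ∀ i, IndepFun (M.x i) (fun ω => (M.w i ω, M.ε i ω)) M.P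
  indep_w : ∀ i, IndepFun (M.w i) (M.ε i) M.P

/-- `b` is a solution of the Lasso problem on the partition `{i | w_i ≤ τ}`, i.e. `b` minimizes
`n⁻¹ ∑_{i : w_i ≤ τ} (y_i - x_iᵀb)² + l ‖b‖₁` over `ℝ^p`. -/
def IsLassoBeta (l τ : ℝ) (ω : M.Ω) (b : Fin p → ℝ) : Prop :=
  IsMinOn (fun b : Fin p → ℝ =>
    1 / (n : ℝ) * ∑ i ∈ Finset.univ.filter (fun i => M.w i ω ≤ τ), (M.y i ω - M.x i ω ⬝ᵥ b) ^ 2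
      + l * lqNorm 1 b) Set.univ b

/-- `g` is a solution of the Lasso problem on the partition `{i | w_i > τ}`. -/
def IsLassoGamma (l τ : ℝ) (ω : M.Ω) (g : Fin p → ℝ) : Prop :=
  IsMinOn (fun g : Fin p → ℝ =>
    1 / (n : ℝ) * ∑ i ∈ Finset.univ.filter (fun i => τ < M.w i ω), (M.y i ω - M.x i ω ⬝ᵥ g) ^ 2
      + l * lqNorm 1 g) Set.univ g

/-- `T(τ₀, u) = {τ ∈ ℝ | |Φ(τ) - Φ(τ₀)| ≤ u}`. -/
def nbhd (u : ℝ) : Set ℝ := {τ | |M.Φ τ - M.Φ M.τ₀| ≤ u}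

/-- "With probability at least `1 - δ`, the property `good` holds", in the form: the outer measure
of the exceptional set is at most `δ`. Thus no measurability of `good` is presupposed; the claim
says that `good` holds on a measurable event of probability at least `1 - δ`. -/
def HoldsWithProb (δ : ℝ) (good : M.Ω → Prop) : Prop :=
  M.P {ω | ¬ good ω} ≤ ENNReal.ofReal δ

end ChangePointModel

/-- The rate `√(log p / n)`. -/
def rate (p n : ℕ) : ℝ := Real.sqrt (Real.log p / n)

end

/-! The core is the deterministic Lasso argument. If the gradient of the quadratic loss at the true
vector is at most `l / 4` in sup norm, the error `v` has its `ℓ₁` mass essentially on the support of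
the truth, so `‖v‖₁² ≤ 16 s ‖v‖₂²`. A lower bound `a ‖v‖₂²` for the quadratic form of the design on
such vectors then gives errors of order `(l / a) s^(1/q)` (`lqNorm_lasso_sub_le`). It remains to
control the gradient and the form, simultaneously for all thresholds `τ` near `τ₀`.

The gradient is noise plus bias. For the noise, the `w_i` are independent of the products `ε_i
x_ij`. Once the `w_i` are fixed and sorted, the sets `{i | w_i ≤ τ}` are initial segments, so the
supremum over `τ` is a maximum of partial sums and Doob's inequality bounds it at no extra cost
(`measure_exists_le_sum_le`). The bias comes only from observations between `τ₀` and `τ`. In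
absolute value these terms are dominated by a sum over one window, the union over all admissible
`τ`, whose probability is at most `u`. A Chernoff bound gives order `ξ (u + log p / n)`, and the
trichotomy on `u` and `ξ` absorbs the second term into `max (rate) (ξ u)`.

The quadratic form grows with the set of observations, so it suffices to treat the observations
lying in every admissible partition, a set of `w`-probability at least `Φmin / 2`. Squares have a
light lower tail, so the bound holds in each fixed direction with exponentially small failure
probability. A union bound covers the sums of `k` signed basis vectors, with `k` of order `s`, and
Maurey's sampling argument extends it to the cone (`measure_not_restricted_eigenvalue_le`).

Each event fails with probability at most a constant times `1 / p`. -/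

section Subgaussian

/-! ### Exponential moments of subgaussian variables, their squares and their products. -/

variable {Ω : Type*} [MeasurableSpace Ω] {P : Measure Ω}

theorem ProbabilityTheory.HasSubgaussianMGF.lintegral_exp_mul_le {X : Ω → ℝ} {c : ℝ≥0}
    (h : HasSubgaussianMGF X c P) (t : ℝ) :
    ∫⁻ ω, ENNReal.ofReal (Real.exp (t * X ω)) ∂P ≤ ENNReal.ofReal (Real.exp (c * t ^ 2 / 2)) := by
  rw [← ofReal_integral_eq_lintegral_ofReal (h.integrable_exp_mul t)
    (ae_of_all _ fun _ => (Real.exp_pos _).le)]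
  exact ENNReal.ofReal_le_ofReal (h.mgf_le t)

theorem lintegral_exp_mul_gaussianReal (t : ℝ) :
    ∫⁻ g, ENNReal.ofReal (Real.exp (t * g)) ∂(gaussianReal 0 1)
      = ENNReal.ofReal (Real.exp (t ^ 2 / 2)) := by
  rw [← ofReal_integral_eq_lintegral_ofReal (integrable_exp_mul_gaussianReal t)
    (ae_of_all _ fun _ => (Real.exp_pos _).le)]
  have := congrFun (mgf_id_gaussianReal (μ := 0) (v := 1)) t
  simp only [mgf, id] at this
  rw [this]
  simp

theorem lintegral_exp_sq_gaussianReal_le :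
    ∫⁻ g, ENNReal.ofReal (Real.exp (g ^ 2 / 4)) ∂(gaussianReal 0 1) ≤ 2 := by
  rw [gaussianReal_of_var_ne_zero _ one_ne_zero,
    lintegral_withDensity_eq_lintegral_mul _ (measurable_gaussianPDF _ _) (by fun_prop)]
  have h1 : ∀ g : ℝ, (gaussianPDF 0 1 * fun g => ENNReal.ofReal (Real.exp (g ^ 2 / 4))) g
      = ENNReal.ofReal ((√(2 * Real.pi))⁻¹ * Real.exp (-(1 / 4) * g ^ 2)) := by
    intro g
    simp only [Pi.mul_apply, gaussianPDF, gaussianPDFReal]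
    rw [← ENNReal.ofReal_mul (by positivity), mul_assoc, ← Real.exp_add]
    congr 3
    · simp
    · simp
      ring
  simp_rw [h1]
  rw [← ofReal_integral_eq_lintegral_ofReal
    ((integrable_exp_neg_mul_sq (by norm_num)).const_mul _)
    (ae_of_all _ fun _ => by positivity), integral_const_mul, integral_gaussian]
  rw [show (2 : ℝ≥0∞) = ENNReal.ofReal 2 by simp]
  apply ENNReal.ofReal_le_ofReal
  rw [← Real.sqrt_inv, ← Real.sqrt_mul (by positivity)]
  rw [show (2 * Real.pi)⁻¹ * (Real.pi / (1 / 4)) = 2 by field_simp; norm_num]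
  rw [Real.sqrt_le_left (by norm_num)]
  norm_num

/-- Gaussian linearization: `exp (X² / (4A))` is the mean of `exp (X g / √(2A))` over a standard
Gaussian `g`. After exchanging the integrals, the subgaussian bound leaves at most the mean of `exp
(g² / 4)`, which is `√2`. -/
theorem ProbabilityTheory.HasSubgaussianMGF.lintegral_exp_sq_le [SFinite P] {X : Ω → ℝ} {c : ℝ≥0}
    (h : HasSubgaussianMGF X c P) (hX : Measurable X) {A : ℝ} (hA : 0 < A) (hc : (c : ℝ) ≤ A) :
    ∫⁻ ω, ENNReal.ofReal (Real.exp (X ω ^ 2 / (4 * A))) ∂P ≤ 2 := by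
  have hs : √(2 * A) ^ 2 = 2 * A := Real.sq_sqrt (by positivity)
  have h1 : ∀ ω, ENNReal.ofReal (Real.exp (X ω ^ 2 / (4 * A)))
      = ∫⁻ g, ENNReal.ofReal (Real.exp (X ω / √(2 * A) * g)) ∂(gaussianReal 0 1) := by
    intro ω
    rw [lintegral_exp_mul_gaussianReal, div_pow, hs]
    congr 2
    field_simp
    norm_num
  simp_rw [h1]
  rw [lintegral_lintegral_swap (by fun_prop)]
  refine le_trans (lintegral_mono fun g => ?_) lintegral_exp_sq_gaussianReal_le
  have h2 : ∀ ω, X ω / √(2 * A) * g = (g / √(2 * A)) * X ω := fun ω => by ring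
  simp_rw [h2]
  refine (h.lintegral_exp_mul_le _).trans (ENNReal.ofReal_le_ofReal (Real.exp_le_exp.2 ?_))
  rw [div_pow, hs]
  have : (c : ℝ) * (g ^ 2 / (2 * A)) / 2 = (c / A) * (g ^ 2 / 4) := by field_simp; norm_num
  rw [this]
  have h3 : (c : ℝ) / A ≤ 1 := (div_le_one hA).2 hc
  nlinarith [sq_nonneg g]

/-- A second-order expansion of `exp (-θ X²)`, valid for every `θ ≥ 0` because the exponent is
nonpositive. The fourth moment in the remainder is dominated by the exponential moment of `X²`. -/
theorem ProbabilityTheory.HasSubgaussianMGF.lintegral_exp_neg_sq_le [IsProbabilityMeasure P]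
    {X : Ω → ℝ} {c : ℝ≥0}
    (h : HasSubgaussianMGF X c P) (hX : Measurable X) {A : ℝ} (hA : 0 < A) (hc : (c : ℝ) ≤ A)
    {κ θ : ℝ} (hθ : 0 ≤ θ) (hκ : κ ≤ ∫ ω, X ω ^ 2 ∂P) :
    ∫⁻ ω, ENNReal.ofReal (Real.exp (-θ * X ω ^ 2)) ∂P
      ≤ ENNReal.ofReal (1 - θ * κ + 32 * θ ^ 2 * A ^ 2) := by
  have hi2 : Integrable (fun ω => X ω ^ 2) P := (h.memLp 2).integrable_sq
  have hexp : Integrable (fun ω => Real.exp (X ω ^ 2 / (4 * A))) P := by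
    refine ⟨by fun_prop, ?_⟩
    rw [hasFiniteIntegral_iff_ofReal (ae_of_all _ fun _ => (Real.exp_pos _).le)]
    exact (h.lintegral_exp_sq_le hX hA hc).trans_lt (by simp)
  have hexp2 : ∫ ω, Real.exp (X ω ^ 2 / (4 * A)) ∂P ≤ 2 := by
    rw [integral_eq_lintegral_of_nonneg_ae (ae_of_all _ fun _ => (Real.exp_pos _).le)
      (by fun_prop)]
    exact ENNReal.toReal_le_of_le_ofReal (by norm_num)
      (by simpa using h.lintegral_exp_sq_le hX hA hc)
  have hpt : ∀ ω, Real.exp (-θ * X ω ^ 2)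
      ≤ 1 - θ * X ω ^ 2 + 16 * θ ^ 2 * A ^ 2 * Real.exp (X ω ^ 2 / (4 * A)) := by
    intro ω
    have hy : 0 ≤ θ * X ω ^ 2 := by positivity
    -- This follows from `exp y ≥ 1 + y + y²/2` and `(1 + y + y²/2)(1 - y + y²/2) = 1 + y⁴/4 ≥ 1`.
    have h1 : Real.exp (-(θ * X ω ^ 2)) ≤ 1 - θ * X ω ^ 2 + (θ * X ω ^ 2) ^ 2 / 2 := by
      have := Real.quadratic_le_exp_of_nonneg hy
      rw [Real.exp_neg, inv_le_comm₀ (Real.exp_pos _) (by nlinarith [sq_nonneg (θ * X ω ^ 2 - 1)])]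
      refine le_trans ?_ this
      rw [inv_le_iff_one_le_mul₀ (by nlinarith [sq_nonneg (θ * X ω ^ 2 - 1)])]
      nlinarith [sq_nonneg ((θ * X ω ^ 2) ^ 2)]
    have h2 := Real.quadratic_le_exp_of_nonneg (x := X ω ^ 2 / (4 * A)) (by positivity)
    have h3 : (X ω ^ 2 / (4 * A)) ^ 2 / 2 ≤ Real.exp (X ω ^ 2 / (4 * A)) := by
      have : 0 ≤ X ω ^ 2 / (4 * A) := by positivity
      linarith
    have h4 : (θ * X ω ^ 2) ^ 2 / 2
        = 16 * θ ^ 2 * A ^ 2 * ((X ω ^ 2 / (4 * A)) ^ 2 / 2) := by field_simp; norm_num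
    rw [neg_mul]
    refine h1.trans ?_
    rw [h4]
    have : 0 ≤ 16 * θ ^ 2 * A ^ 2 := by positivity
    nlinarith
  have hint : Integrable (fun ω => Real.exp (-θ * X ω ^ 2)) P := by
    refine Integrable.of_bound (by fun_prop) 1 (ae_of_all _ fun ω => ?_)
    rw [Real.norm_eq_abs, abs_of_pos (Real.exp_pos _), Real.exp_le_one_iff]
    nlinarith [mul_nonneg hθ (sq_nonneg (X ω))]
  rw [← ofReal_integral_eq_lintegral_ofReal hint (ae_of_all _ fun _ => (Real.exp_pos _).le)]
  apply ENNReal.ofReal_le_ofReal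
  have hi3 : Integrable (fun ω => 1 - θ * X ω ^ 2) P := (integrable_const 1).sub (hi2.const_mul θ)
  refine (integral_mono hint (hi3.add (hexp.const_mul (16 * θ ^ 2 * A ^ 2))) hpt).trans ?_
  rw [integral_add' hi3 (hexp.const_mul _), integral_sub (integrable_const 1) (hi2.const_mul θ),
    integral_const_mul, integral_const_mul]
  simp only [integral_const, probReal_univ, smul_eq_mul, mul_one]
  have h5 : 0 ≤ 16 * θ ^ 2 * A ^ 2 := by positivity
  nlinarith

/-- The arithmetic-geometric mean inequality is used twice, in the exponent and on the two
exponentials; no independence is needed. -/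
theorem lintegral_exp_abs_mul_le {X Y : Ω → ℝ} {a : ℝ} (ha : 0 < a) (hX : Measurable X)
    (h1 : ∫⁻ ω, ENNReal.ofReal (Real.exp (X ω ^ 2 / a)) ∂P ≤ 2)
    (h2 : ∫⁻ ω, ENNReal.ofReal (Real.exp (Y ω ^ 2 / a)) ∂P ≤ 2) :
    ∫⁻ ω, ENNReal.ofReal (Real.exp (|X ω| * |Y ω| / a)) ∂P ≤ 2 := by
  have hpt : ∀ ω, ENNReal.ofReal (Real.exp (|X ω| * |Y ω| / a))
      ≤ 2⁻¹ * (ENNReal.ofReal (Real.exp (X ω ^ 2 / a))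
        + ENNReal.ofReal (Real.exp (Y ω ^ 2 / a))) := by
    intro ω
    rw [← ENNReal.ofReal_add (Real.exp_pos _).le (Real.exp_pos _).le,
      show (2⁻¹ : ℝ≥0∞) = ENNReal.ofReal (2⁻¹) by
        rw [ENNReal.ofReal_inv_of_pos (by norm_num)]; simp, ← ENNReal.ofReal_mul (by norm_num)]
    apply ENNReal.ofReal_le_ofReal
    have e1 : |X ω| * |Y ω| / a ≤ X ω ^ 2 / a / 2 + Y ω ^ 2 / a / 2 := by
      rw [div_div, div_div, ← add_div, div_le_div_iff₀ ha (by positivity)]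
      nlinarith [sq_nonneg (|X ω| - |Y ω|), sq_abs (X ω), sq_abs (Y ω)]
    have e2 := Real.exp_le_exp.2 e1
    rw [Real.exp_add] at e2
    have e3 : Real.exp (X ω ^ 2 / a) = Real.exp (X ω ^ 2 / a / 2) ^ 2 := by
      rw [← Real.exp_nat_mul]; congr 1; push_cast; ring
    have e4 : Real.exp (Y ω ^ 2 / a) = Real.exp (Y ω ^ 2 / a / 2) ^ 2 := by
      rw [← Real.exp_nat_mul]; congr 1; push_cast; ring
    rw [e3, e4]
    nlinarith [sq_nonneg (Real.exp (X ω ^ 2 / a / 2) - Real.exp (Y ω ^ 2 / a / 2))]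
  refine (lintegral_mono hpt).trans ?_
  rw [lintegral_const_mul' _ _ (by simp), lintegral_add_left (by fun_prop)]
  calc (2⁻¹ : ℝ≥0∞) * (_ + _) ≤ 2⁻¹ * (2 + 2) := by gcongr
    _ = 2 := by
      rw [← two_mul, ← mul_assoc, ENNReal.inv_mul_cancel (by simp) (by simp), one_mul]

/-- Integrating out `Y` first leaves `exp (r X² / (4A))` with `r = 2ABθ² ≤ 1`. Convexity gives `exp
(r y) ≤ 1 - r + r exp y`, so the mean is at most `1 + r`, quadratic in `θ`. -/
theorem lintegral_exp_mul_indep_le [IsProbabilityMeasure P] {X Y : Ω → ℝ} {c d : ℝ≥0}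
    (hX : HasSubgaussianMGF X c P) (hY : HasSubgaussianMGF Y d P)
    (mX : Measurable X) (mY : Measurable Y) (hXY : IndepFun X Y P)
    {A : ℝ} (hA : 0 < A) (hc : (c : ℝ) ≤ A) {B : ℝ} (hd : (d : ℝ) ≤ B) {θ : ℝ}
    (hθ : 2 * A * B * θ ^ 2 ≤ 1) :
    ∫⁻ ω, ENNReal.ofReal (Real.exp (θ * (X ω * Y ω))) ∂P
      ≤ ENNReal.ofReal (Real.exp (2 * A * B * θ ^ 2)) := by
  have hB : 0 ≤ B := d.2.trans hd
  set r := 2 * A * B * θ ^ 2 with hr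
  have hr0 : 0 ≤ r := by positivity
  have hmap : ∫⁻ ω, ENNReal.ofReal (Real.exp (θ * (X ω * Y ω))) ∂P
      = ∫⁻ z, ENNReal.ofReal (Real.exp (θ * (z.1 * z.2))) ∂((P.map X).prod (P.map Y)) := by
    rw [← (indepFun_iff_map_prod_eq_prod_map_map mX.aemeasurable mY.aemeasurable).1 hXY,
      lintegral_map (by fun_prop) (by fun_prop)]
  have : IsProbabilityMeasure (P.map Y) := Measure.isProbabilityMeasure_map mY.aemeasurable
  rw [hmap, lintegral_prod _ (by fun_prop), lintegral_map (by fun_prop) mX]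
  have hpt : ∀ ω, ∫⁻ y, ENNReal.ofReal (Real.exp (θ * (X ω * y))) ∂(P.map Y)
      ≤ ENNReal.ofReal (1 - r) + ENNReal.ofReal r *
        ENNReal.ofReal (Real.exp (X ω ^ 2 / (4 * A))) := by
    intro ω
    rw [lintegral_map (by fun_prop) mY]
    simp_rw [← mul_assoc]
    refine (hY.lintegral_exp_mul_le _).trans ?_
    rw [← ENNReal.ofReal_mul hr0, ← ENNReal.ofReal_add (by linarith) (by positivity)]
    apply ENNReal.ofReal_le_ofReal
    set y := X ω ^ 2 / (4 * A) with hy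
    have h1 : (d : ℝ) * (θ * X ω) ^ 2 / 2 ≤ (1 - r) * 0 + r * y := by
      have : r * y = B * (θ * X ω) ^ 2 / 2 := by rw [hr, hy]; field_simp; ring
      rw [this]
      nlinarith [mul_nonneg (sub_nonneg.2 hd) (sq_nonneg (θ * X ω))]
    refine (Real.exp_le_exp.2 h1).trans ?_
    have := convexOn_exp.2 (Set.mem_univ (0 : ℝ)) (Set.mem_univ y) (sub_nonneg.2 hθ) hr0
      (by ring)
    simpa using this
  refine (lintegral_mono hpt).trans ?_
  rw [lintegral_add_left (by fun_prop), lintegral_const_mul' _ _ (by simp)]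
  calc _ ≤ ENNReal.ofReal (1 - r) + ENNReal.ofReal r * 2 := by
        gcongr
        · simp
        · exact hX.lintegral_exp_sq_le mX hA hc
    _ = ENNReal.ofReal (1 + r) := by
        rw [show (2 : ℝ≥0∞) = ENNReal.ofReal 2 by simp, ← ENNReal.ofReal_mul hr0,
          ← ENNReal.ofReal_add (by linarith) (by linarith)]
        congr 1; ring
    _ ≤ _ := ENNReal.ofReal_le_ofReal (by linarith [Real.add_one_le_exp r])

end Subgaussian

/-! ### Chernoff bounds over a random window. -/

/-- Chernoff's bound for a sum of independent variables `f (x i)`, restricted to those `i` for which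
an independent variable `w i` falls into the window `A`. -/
theorem measure_sum_indicator_ge_le {Ω 𝓧 : Type*} [MeasurableSpace Ω] [MeasurableSpace 𝓧]
    {P : Measure Ω} [IsProbabilityMeasure P] {n : ℕ} {w : Fin n → Ω → ℝ} {x : Fin n → Ω → 𝓧}
    (mw : ∀ i, Measurable (w i)) (mx : ∀ i, Measurable (x i))
    (hind : iIndepFun (fun i ω => (x i ω, w i ω)) P) (hxw : ∀ i, IndepFun (x i) (w i) P)
    {ν : Measure ℝ} [IsProbabilityMeasure ν] (hw : ∀ i, P.map (w i) = ν)
    {f : 𝓧 → ℝ} (mf : Measurable f) {A : Set ℝ} (mA : MeasurableSet A) {B : ℝ} (hB0 : 0 ≤ B)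
    (hB : ∀ i, ∫⁻ ω, ENNReal.ofReal (Real.exp (f (x i ω))) ∂P ≤ ENNReal.ofReal B) (t : ℝ) :
    P {ω | t ≤ ∑ i, A.indicator (fun _ => (1 : ℝ)) (w i ω) * f (x i ω)}
      ≤ ENNReal.ofReal (Real.exp (-t + n * ν.real A * (B - 1))) := by
  have m1 : Measurable (A.indicator (fun _ => (1 : ℝ))) := measurable_const.indicator mA
  set g : Fin n → Ω → ℝ≥0∞ := fun i ω =>
    ENNReal.ofReal (Real.exp (A.indicator (fun _ => (1 : ℝ)) (w i ω) * f (x i ω))) with hg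
  have mg : ∀ i, Measurable (g i) := fun i =>
    ((((m1.comp (mw i)).mul (mf.comp (mx i)))).exp).ennreal_ofReal
  have hgi : iIndepFun g P := hind.comp
    (fun _ z => ENNReal.ofReal (Real.exp (A.indicator (fun _ => (1 : ℝ)) z.2 * f z.1)))
    (fun _ => ((((m1.comp measurable_snd).mul (mf.comp measurable_fst))).exp).ennreal_ofReal)
  have hπ0 : 0 ≤ ν.real A := measureReal_nonneg
  have hπ1 : ν.real A ≤ 1 := measureReal_le_one
  have hone : ∀ i, ∫⁻ ω, g i ω ∂P ≤ ENNReal.ofReal (Real.exp (ν.real A * (B - 1))) := by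
    intro i
    -- Only the event `w i ∈ A` contributes a factor different from `1`. The exponent therefore
    -- scales with the expected count `n ν(A)` and not with `n`.
    have hdec : ∀ ω, g i ω = Aᶜ.indicator (fun _ => (1 : ℝ≥0∞)) (w i ω)
        + A.indicator (fun _ => (1 : ℝ≥0∞)) (w i ω) * ENNReal.ofReal (Real.exp (f (x i ω))) := by
      intro ω
      by_cases h : w i ω ∈ A <;> simp [hg, h]
    simp_rw [hdec]
    have mi : ∀ A : Set ℝ, MeasurableSet A →
        Measurable (fun ω => A.indicator (fun _ => (1 : ℝ≥0∞)) (w i ω)) := fun A mA =>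
      (measurable_const.indicator mA).comp (mw i)
    have hm : ∀ A : Set ℝ, MeasurableSet A →
        ∫⁻ ω, A.indicator (fun _ => (1 : ℝ≥0∞)) (w i ω) ∂P = ENNReal.ofReal (ν.real A) := by
      intro A mA
      rw [← lintegral_map (f := A.indicator (fun _ => (1 : ℝ≥0∞)))
        (measurable_const.indicator mA) (mw i), hw i,
        lintegral_indicator_const mA, one_mul, ofReal_measureReal]
    rw [lintegral_add_left (mi _ mA.compl)]
    have hmul := lintegral_mul_eq_lintegral_mul_lintegral_of_indepFun'' (μ := P)
      (f := fun ω => A.indicator (fun _ => (1 : ℝ≥0∞)) (w i ω))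
      (g := fun ω => ENNReal.ofReal (Real.exp (f (x i ω)))) (mi A mA).aemeasurable
      ((mf.comp (mx i)).exp.ennreal_ofReal).aemeasurable
      ((hxw i).symm.comp (measurable_const.indicator mA)
        (φ := A.indicator (fun _ => (1 : ℝ≥0∞)))
        (ψ := fun z => ENNReal.ofReal (Real.exp (f z))) mf.exp.ennreal_ofReal)
    rw [hmul, hm A mA, hm _ mA.compl, measureReal_compl mA, probReal_univ]
    calc _ ≤ ENNReal.ofReal (1 - ν.real A) + ENNReal.ofReal (ν.real A) * ENNReal.ofReal B := by
          gcongr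
          exact hB i
      _ = ENNReal.ofReal (1 - ν.real A + ν.real A * B) := by
          rw [← ENNReal.ofReal_mul hπ0, ← ENNReal.ofReal_add (by linarith) (by positivity)]
      _ ≤ _ := ENNReal.ofReal_le_ofReal (by linarith [Real.add_one_le_exp (ν.real A * (B - 1))])
  have hprod : ∫⁻ ω, ∏ i, g i ω ∂P ≤ ENNReal.ofReal (Real.exp (n * ν.real A * (B - 1))) := by
    have := lintegral_prod_eq_prod_lintegral_of_indepFun (μ := P) Finset.univ g hgi mg
    rw [this]
    refine (Finset.prod_le_prod' fun i _ => hone i).trans ?_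
    rw [Finset.prod_const, Finset.card_univ, Fintype.card_fin,
      ← ENNReal.ofReal_pow (Real.exp_pos _).le, ← Real.exp_nat_mul, mul_assoc]
  have hsub : {ω | t ≤ ∑ i, A.indicator (fun _ => (1 : ℝ)) (w i ω) * f (x i ω)}
      ⊆ {ω | ENNReal.ofReal (Real.exp t) ≤ ∏ i, g i ω} := by
    intro ω hω
    simp only [Set.mem_ofPred_eq] at hω ⊢
    rw [hg, ← ENNReal.ofReal_prod_of_nonneg (fun _ _ => (Real.exp_pos _).le), ← Real.exp_sum]
    exact ENNReal.ofReal_le_ofReal (Real.exp_le_exp.2 hω)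
  refine (measure_mono hsub).trans ?_
  have hmk := meas_ge_le_lintegral_div (μ := P) (f := fun ω => ∏ i, g i ω)
    (Finset.measurable_fun_prod _ fun i _ => mg i).aemeasurable
    (ε := ENNReal.ofReal (Real.exp t)) (by simp [Real.exp_pos]) (by simp)
  refine hmk.trans ((ENNReal.div_le_div_right hprod _).trans ?_)
  rw [← ENNReal.ofReal_div_of_pos (Real.exp_pos _), ← Real.exp_sub]
  exact ENNReal.ofReal_le_ofReal (Real.exp_le_exp.2 (by linarith))

/-! ### Maurey's sampling argument. -/

/-- The mean of a quadratic form at a sum of `k` independent copies of a finitely supported random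
vector. -/
theorem sum_prod_mul_bilinForm {V ι : Type*} [AddCommGroup V] [Module ℝ V] [Fintype ι]
    (B : LinearMap.BilinForm ℝ V) (a : ι → ℝ) (ha : ∑ j, a j = 1) (c : ι → V) (k : ℕ) (t : V) :
    ∑ f : Fin k → ι, (∏ l, a (f l)) * B (t + ∑ l, c (f l)) (t + ∑ l, c (f l))
      = B (t + (k : ℝ) • ∑ j, a j • c j) (t + (k : ℝ) • ∑ j, a j • c j)
        + k * (∑ j, a j * B (c j) (c j) - B (∑ j, a j • c j) (∑ j, a j • c j)) := by
  induction k generalizing t with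
  | zero => simp
  | succ k ih =>
    set μ := ∑ j, a j • c j with hμ
    -- Condition on the first draw and absorb it into the shift `t`; this is why the induction is
    -- over all `t`.
    rw [← (Fin.consEquiv fun _ => ι).sum_comp, Fintype.sum_prod_type]
    have h1 : ∀ j, ∑ g : Fin k → ι, (∏ l, a ((Fin.consEquiv fun _ => ι) (j, g) l)) *
        B (t + ∑ l, c ((Fin.consEquiv fun _ => ι) (j, g) l))
          (t + ∑ l, c ((Fin.consEquiv fun _ => ι) (j, g) l))
        = a j * (B (t + (k : ℝ) • μ) (t + (k : ℝ) • μ) + B (t + (k : ℝ) • μ) (c j)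
          + B (c j) (t + (k : ℝ) • μ) + B (c j) (c j)
          + k * (∑ j, a j * B (c j) (c j) - B μ μ)) := by
      intro j
      have := ih (t + c j)
      simp only [Fin.consEquiv_apply, Fin.prod_univ_succ, Fin.sum_univ_succ, Fin.cons_zero,
        Fin.cons_succ]
      simp_rw [mul_assoc, ← add_assoc]
      rw [← Finset.mul_sum, this]
      congr 1
      rw [show t + c j + (k : ℝ) • μ = (t + (k : ℝ) • μ) + c j by abel]
      simp only [map_add, LinearMap.add_apply]
      ring
    rw [Finset.sum_congr rfl fun j _ => h1 j]
    have h2 : ∑ j, a j * B (t + (k : ℝ) • μ) (c j) = B (t + (k : ℝ) • μ) μ := by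
      rw [hμ, map_sum]; simp
    have h3 : ∑ j, a j * B (c j) (t + (k : ℝ) • μ) = B μ (t + (k : ℝ) • μ) := by
      conv_rhs => rw [hμ, map_sum, LinearMap.sum_apply]
      simp [hμ]
    simp only [mul_add, Finset.sum_add_distrib, h2, h3, ← Finset.sum_mul, ha]
    have h4 : t + ((k + 1 : ℕ) : ℝ) • μ = (t + (k : ℝ) • μ) + μ := by
      push_cast; rw [add_smul, one_smul, add_assoc]
    rw [h4]
    simp only [map_add, LinearMap.add_apply, one_mul]
    push_cast
    ring

/-- Maurey's argument: a quadratic form that is nonnegative at all sums of `k` signed basis vectors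
is bounded below by a small multiple of `-‖v‖₁²`. -/
theorem neg_sq_sum_abs_mul_le_bilinForm {p : ℕ} (B : LinearMap.BilinForm ℝ (Fin p → ℝ)) {k : ℕ}
    (hk : 1 ≤ k)
    (hB : ∀ f : Fin k → Fin p × Bool, 0 ≤
      B (∑ l, Pi.single (f l).1 (if (f l).2 then 1 else -1))
        (∑ l, Pi.single (f l).1 (if (f l).2 then 1 else -1)))
    {D : ℝ} (hD : ∀ j, B (Pi.single j 1) (Pi.single j 1) ≤ D) (v : Fin p → ℝ) :
    -((∑ j, |v j|) ^ 2 * D) ≤ (k - 1) * B v v := by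
  rcases eq_or_ne v 0 with rfl | hv
  · simp
  set R := ∑ j, |v j| with hR
  have hR0 : 0 < R := by
    obtain ⟨j, hj⟩ := Function.ne_iff.1 hv
    exact Finset.sum_pos' (fun _ _ => abs_nonneg _) ⟨j, Finset.mem_univ _, abs_pos.2 hj⟩
  -- Draw the signed basis vector `sign (v j) e_j` with probability `|v j| / ‖v‖₁`; its mean is `v /
  -- ‖v‖₁`.
  have key := sum_prod_mul_bilinForm B (fun j => |v j| / R)
    (by rw [← Finset.sum_div, ← hR, div_self hR0.ne'])
    (fun j => Pi.single j (if 0 ≤ v j then (1 : ℝ) else -1)) k 0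
  have hμ : ∑ j, (|v j| / R) • (Pi.single j (if 0 ≤ v j then (1 : ℝ) else -1) : Fin p → ℝ)
      = R⁻¹ • v := by
    ext i
    rw [Finset.sum_apply, Finset.sum_eq_single i]
    · simp only [Pi.smul_apply, Pi.single_eq_same, smul_eq_mul]
      split_ifs with h
      · rw [abs_of_nonneg h]; ring
      · rw [abs_of_neg (not_le.1 h)]; ring
    · intro j _ hj
      simp [Pi.single_eq_of_ne hj.symm]
    · simp
  rw [hμ] at key
  have hpos : 0 ≤ ∑ f : Fin k → Fin p, (∏ l, |v (f l)| / R) *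
      B (0 + ∑ l, Pi.single (f l) (if 0 ≤ v (f l) then (1 : ℝ) else -1))
        (0 + ∑ l, Pi.single (f l) (if 0 ≤ v (f l) then (1 : ℝ) else -1)) := by
    refine Finset.sum_nonneg fun f _ => mul_nonneg (by positivity) ?_
    have := hB fun l => (f l, decide (0 ≤ v (f l)))
    simpa using this
  rw [key] at hpos
  have hdiag : ∑ j, |v j| / R * B (Pi.single j (if 0 ≤ v j then (1 : ℝ) else -1))
      (Pi.single j (if 0 ≤ v j then (1 : ℝ) else -1)) ≤ D := by
    have h1 : ∀ j, B (Pi.single j (if 0 ≤ v j then (1 : ℝ) else -1))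
        (Pi.single j (if 0 ≤ v j then (1 : ℝ) else -1)) ≤ D := by
      intro j
      split_ifs
      · exact hD j
      · rw [Pi.single_neg]; simpa using hD j
    calc _ ≤ ∑ j, |v j| / R * D := by gcongr with j; exact h1 j
      _ = D := by rw [← Finset.sum_mul, ← Finset.sum_div, ← hR, div_self hR0.ne', one_mul]
  simp only [zero_add, map_smul, LinearMap.smul_apply, smul_eq_mul] at hpos
  have hk' : (1 : ℝ) ≤ k := by exact_mod_cast hk
  have h2 : 0 ≤ k * (k * (R⁻¹ * (R⁻¹ * (B v) v))) + k * (D - R⁻¹ * (R⁻¹ * (B v) v)) := by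
    have : (k : ℝ) * (R⁻¹ * (k * (R⁻¹ * (B v) v))) = k * (k * (R⁻¹ * (R⁻¹ * (B v) v))) := by ring
    nlinarith
  -- The squared mean contributes `k²` times the form at `v / R` and the variance removes `k` times
  -- it; dividing by `k` leaves `k - 1`.
  have h3 : 0 ≤ (k - 1) * (R⁻¹ * (R⁻¹ * (B v) v)) + D := by
    by_contra hneg
    push Not at hneg
    nlinarith
  have h4 : (k - 1) * B v v + R ^ 2 * D = R ^ 2 * ((k - 1) * (R⁻¹ * (R⁻¹ * (B v) v)) + D) := by
    field_simp
  nlinarith [mul_nonneg (sq_nonneg R) h3]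

/-! ### Maximal inequalities over ordered partitions. -/

/-- Doob's maximal inequality for the exponentials of the partial sums of independent variables. -/
theorem pi_exists_le_partial_sum_le {θ : ℝ} (hθ : 0 ≤ θ) (k : ℕ) (μ : Fin k → Measure ℝ)
    [∀ i, IsProbabilityMeasure (μ i)]
    (hμ : ∀ i, 1 ≤ ∫⁻ z, ENNReal.ofReal (Real.exp (θ * z)) ∂μ i) (t : ℝ) :
    Measure.pi μ {z | ∃ m : ℕ, t ≤ ∑ i : Fin k, if i.val < m then z i else 0}
      ≤ ENNReal.ofReal (Real.exp (-(θ * t)))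
        * ∏ i, ∫⁻ z, ENNReal.ofReal (Real.exp (θ * z)) ∂μ i := by
  -- For `t ≤ 0` the right side is at least `1`, because all exponential moments are. The induction
  -- needs this case, since the level remaining after the first coordinate may be negative.
  have htriv : ∀ {k : ℕ} (μ : Fin k → Measure ℝ) [∀ i, IsProbabilityMeasure (μ i)]
      (_ : ∀ i, 1 ≤ ∫⁻ z, ENNReal.ofReal (Real.exp (θ * z)) ∂μ i) {t : ℝ} (_ : t ≤ 0)
      (S : Set (Fin k → ℝ)), Measure.pi μ S ≤ ENNReal.ofReal (Real.exp (-(θ * t)))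
        * ∏ i, ∫⁻ z, ENNReal.ofReal (Real.exp (θ * z)) ∂μ i := by
    intro k μ _ hμ t ht S
    refine prob_le_one.trans ?_
    have h1 : (1 : ℝ≥0∞) ≤ ENNReal.ofReal (Real.exp (-(θ * t))) := by
      rw [ENNReal.one_le_ofReal, Real.one_le_exp_iff]
      nlinarith
    calc (1 : ℝ≥0∞) = 1 * ∏ _i : Fin k, 1 := by simp
      _ ≤ _ := mul_le_mul' h1 (Finset.prod_le_prod' fun i _ => hμ i)
  induction k generalizing t with
  | zero =>
    rcases le_or_gt t 0 with ht | ht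
    · exact htriv μ hμ ht _
    · simp [ht.not_ge]
  | succ k ih =>
    rcases le_or_gt t 0 with ht | ht
    · exact htriv μ hμ ht _
    have mS : ∀ r : ℝ, MeasurableSet
        {q : ℝ × (Fin k → ℝ) | ∃ m : ℕ, r - q.1 ≤ ∑ i : Fin k, if i.val < m then q.2 i else 0} := by
      intro r
      simp only [Set.ofPred_exists]
      refine MeasurableSet.iUnion fun m => measurableSet_le (by fun_prop) ?_
      refine Finset.measurable_fun_sum _ fun i _ => ?_
      split_ifs <;> fun_prop
    have hsub : {z : Fin (k + 1) → ℝ |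
          ∃ m : ℕ, t ≤ ∑ i : Fin (k + 1), if i.val < m then z i else 0}
        ⊆ MeasurableEquiv.piFinSuccAbove (fun _ => ℝ) 0 ⁻¹'
          {q | ∃ m : ℕ, t - q.1 ≤ ∑ i : Fin k, if i.val < m then q.2 i else 0} := by
      rintro z ⟨m, hm⟩
      -- The empty partial sum cannot reach `t > 0`, so the first coordinate is always included and
      -- the others must reach `t - z 0`.
      rcases m with _ | m
      · simp at hm; linarith
      · refine ⟨m, ?_⟩
        rw [Fin.sum_univ_succ] at hm
        simp only [Fin.val_zero, Nat.zero_lt_succ, if_true, Fin.val_succ,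
          Nat.add_lt_add_iff_right] at hm
        simp only [MeasurableEquiv.piFinSuccAbove_apply, Fin.insertNthEquiv_symm_apply,
          Fin.removeNth_zero, Fin.tail]
        linarith
    refine (measure_mono hsub).trans ?_
    rw [(measurePreserving_piFinSuccAbove μ 0).measure_preimage (mS t).nullMeasurableSet,
      Measure.prod_apply (mS t), Fin.prod_univ_succ]
    set M := ∏ i : Fin k, ∫⁻ z, ENNReal.ofReal (Real.exp (θ * z)) ∂μ i.succ
    calc _ ≤ ∫⁻ x, ENNReal.ofReal (Real.exp (-(θ * t)))
            * ENNReal.ofReal (Real.exp (θ * x)) * M ∂μ 0 := by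
          refine lintegral_mono fun x => ?_
          have := ih (fun i => μ i.succ) (fun i => hμ i.succ) (t - x)
          refine (le_trans (le_of_eq ?_) this).trans (le_of_eq ?_)
          · rfl
          · rw [← ENNReal.ofReal_mul (Real.exp_pos _).le, ← Real.exp_add]
            congr 3
            ring
      _ = _ := by
          rw [lintegral_mul_const _ (by fun_prop), lintegral_const_mul _ (by fun_prop), mul_assoc]

section Ordered

variable {Ω : Type*} [MeasurableSpace Ω] {P : Measure Ω} [IsProbabilityMeasure P] {n : ℕ}

/-- After sorting the indices by `w`, each set `{i | w i ≤ τ}` is an initial segment, ties included.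
Permuting independent variables keeps them independent, so the bound for partial sums applies. -/
theorem measure_exists_le_sum_le_of_weights {Z : Fin n → Ω → ℝ} (mZ : ∀ i, Measurable (Z i))
    (hZ : iIndepFun Z P) {θ : ℝ} (hθ : 0 ≤ θ)
    (h1 : ∀ i, 1 ≤ ∫⁻ ω, ENNReal.ofReal (Real.exp (θ * Z i ω)) ∂P) (w : Fin n → ℝ) (t : ℝ) :
    P {ω | ∃ τ : ℝ, t ≤ ∑ i, if w i ≤ τ then Z i ω else 0}
      ≤ ENNReal.ofReal (Real.exp (-(θ * t)))
        * ∏ i, ∫⁻ ω, ENNReal.ofReal (Real.exp (θ * Z i ω)) ∂P := by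
  set σ := Tuple.sort w with hσ
  have hmono : Monotone (w ∘ σ) := Tuple.monotone_sort w
  have hlow : ∀ τ : ℝ, ∃ m : ℕ, ∀ i : Fin n, w (σ i) ≤ τ ↔ i.val < m := by
    intro τ
    classical
    have hex : ∃ m : ℕ, ∀ i : Fin n, w (σ i) ≤ τ → i.val < m := ⟨n, fun i _ => i.2⟩
    refine ⟨Nat.find hex, fun i => ⟨Nat.find_spec hex i, fun hi => ?_⟩⟩
    by_contra hni
    refine Nat.find_min hex hi fun j hj => ?_
    by_contra hji
    exact hni ((hmono (show i ≤ j from Fin.le_def.2 (not_lt.1 hji))).trans hj)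
  have hprob : ∀ i, IsProbabilityMeasure (P.map (Z (σ i))) := fun i =>
    Measure.isProbabilityMeasure_map (mZ _).aemeasurable
  have hint : ∀ i, ∫⁻ z, ENNReal.ofReal (Real.exp (θ * z)) ∂(P.map (Z (σ i)))
      = ∫⁻ ω, ENNReal.ofReal (Real.exp (θ * Z (σ i) ω)) ∂P := fun i =>
    lintegral_map (by fun_prop) (mZ _)
  have key := pi_exists_le_partial_sum_le hθ n (fun i => P.map (Z (σ i)))
    (fun i => by rw [hint]; exact h1 _) t
  simp_rw [hint] at key
  rw [Equiv.prod_comp σ fun i => ∫⁻ ω, ENNReal.ofReal (Real.exp (θ * Z i ω)) ∂P] at key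
  refine le_trans ?_ key
  rw [← (iIndepFun_iff_map_fun_eq_pi_map (fun i => (mZ (σ i)).aemeasurable)).1
    (hZ.precomp σ.injective)]
  have hm : Measurable fun ω i => Z (σ i) ω := measurable_pi_lambda _ fun i => mZ _
  refine le_trans (measure_mono ?_) (Measure.le_map_apply hm.aemeasurable _)
  rintro ω ⟨τ, hτ⟩
  obtain ⟨m, hm⟩ := hlow τ
  refine ⟨m, ?_⟩
  rw [← Equiv.sum_comp σ] at hτ
  simpa only [hm] using hτ

/-- A maximal inequality for the sums of independent variables `Z i` over the sets
`{i | W i ≤ τ}`, where the `W i` are independent of the `Z i`. -/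
theorem measure_exists_le_sum_le {W Z : Fin n → Ω → ℝ} (mW : ∀ i, Measurable (W i))
    (mZ : ∀ i, Measurable (Z i)) (hind : iIndepFun (fun i ω => (W i ω, Z i ω)) P)
    (hWZ : ∀ i, IndepFun (W i) (Z i) P) {θ : ℝ} (hθ : 0 ≤ θ) {r : ℝ}
    (h1 : ∀ i, 1 ≤ ∫⁻ ω, ENNReal.ofReal (Real.exp (θ * Z i ω)) ∂P)
    (h2 : ∀ i, ∫⁻ ω, ENNReal.ofReal (Real.exp (θ * Z i ω)) ∂P ≤ ENNReal.ofReal (Real.exp r))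
    {t : ℝ} (ht : 0 < t) :
    P {ω | ∃ τ : ℝ, t ≤ ∑ i, if W i ω ≤ τ then Z i ω else 0}
      ≤ ENNReal.ofReal (Real.exp (-(θ * t) + n * r)) := by
  have hpW : ∀ i, IsProbabilityMeasure (P.map (W i)) := fun i =>
    Measure.isProbabilityMeasure_map (mW _).aemeasurable
  have hpZ : ∀ i, IsProbabilityMeasure (P.map (Z i)) := fun i =>
    Measure.isProbabilityMeasure_map (mZ _).aemeasurable
  have hZ : iIndepFun Z P := hind.comp (fun _ q => q.2) (fun _ => measurable_snd)
  have hmapZ := (iIndepFun_iff_map_fun_eq_pi_map (fun i => (mZ i).aemeasurable)).1 hZ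
  -- Independence across `i` and inside each pair makes the whole family `W` independent of the
  -- whole family `Z`; the bound can then be proved for each frozen `W`.
  have hjoint : P.map (fun ω => ((fun i => W i ω), fun i => Z i ω))
      = (Measure.pi fun i => P.map (W i)).prod (Measure.pi fun i => P.map (Z i)) := by
    rw [← (measurePreserving_arrowProdEquivProdArrow ℝ ℝ (Fin n) (fun i => P.map (W i))
      (fun i => P.map (Z i))).map_eq]
    have h3 : (fun i => (P.map (W i)).prod (P.map (Z i)))
        = fun i => P.map (fun ω => (W i ω, Z i ω)) := by
      ext1 i
      exact ((indepFun_iff_map_prod_eq_prod_map_map (mW i).aemeasurable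
        (mZ i).aemeasurable).1 (hWZ i)).symm
    rw [h3, ← (iIndepFun_iff_map_fun_eq_pi_map
      (fun i => ((mW i).prodMk (mZ i)).aemeasurable)).1 hind,
      Measure.map_map (MeasurableEquiv.measurable _)
        (measurable_pi_lambda _ fun i => (mW i).prodMk (mZ i))]
    rfl
  set S : Set ((Fin n → ℝ) × (Fin n → ℝ)) :=
    {q | ∃ j, t ≤ ∑ i, if q.1 i ≤ q.1 j then q.2 i else 0} with hS
  have mS : MeasurableSet S := by
    simp only [hS, Set.ofPred_exists]
    refine MeasurableSet.iUnion fun j => measurableSet_le (by fun_prop) ?_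
    refine Finset.measurable_fun_sum _ fun i _ => Measurable.ite ?_ (by fun_prop) (by fun_prop)
    exact measurableSet_le (by fun_prop) (by fun_prop)
  have hsub : {ω | ∃ τ : ℝ, t ≤ ∑ i, if W i ω ≤ τ then Z i ω else 0}
      ⊆ (fun ω => ((fun i => W i ω), fun i => Z i ω)) ⁻¹' S := by
    rintro ω ⟨τ, hτ⟩
    -- Since `t > 0` the index set is nonempty, and `τ` may be lowered to the largest `W j ≤ τ`.
    -- Thus finitely many thresholds suffice and the event is measurable.
    have hne : (Finset.univ.filter fun i => W i ω ≤ τ).Nonempty := by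
      by_contra hemp
      rw [Finset.not_nonempty_iff_eq_empty] at hemp
      rw [← Finset.sum_filter, hemp, Finset.sum_empty] at hτ
      linarith
    obtain ⟨j, hj, hmax⟩ := Finset.exists_max_image _ (fun i => W i ω) hne
    simp only [Finset.mem_filter, Finset.mem_univ, true_and] at hj hmax
    refine ⟨j, ?_⟩
    have : ∀ i, W i ω ≤ W j ω ↔ W i ω ≤ τ := fun i => ⟨fun h => h.trans hj, hmax i⟩
    simpa only [this] using hτ
  refine (measure_mono hsub).trans ?_
  have mWZ : Measurable fun ω => ((fun i => W i ω), fun i => Z i ω) :=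
    (measurable_pi_lambda _ mW).prodMk (measurable_pi_lambda _ mZ)
  rw [← Measure.map_apply mWZ mS, hjoint, Measure.prod_apply mS]
  have hslice : ∀ w, (Measure.pi fun i => P.map (Z i)) (Prod.mk w ⁻¹' S)
      ≤ ENNReal.ofReal (Real.exp (-(θ * t) + n * r)) := by
    intro w
    rw [← hmapZ, Measure.map_apply (measurable_pi_lambda _ mZ) (measurable_prodMk_left mS)]
    refine le_trans (measure_mono ?_)
      ((measure_exists_le_sum_le_of_weights mZ hZ hθ h1 w t).trans ?_)
    · rintro ω ⟨j, hj⟩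
      exact ⟨w j, hj⟩
    · calc _ ≤ ENNReal.ofReal (Real.exp (-(θ * t)))
            * ∏ _i : Fin n, ENNReal.ofReal (Real.exp r) := by
            gcongr with i
            exact h2 i
        _ = _ := by
            rw [Finset.prod_const, Finset.card_univ, Fintype.card_fin,
              ← ENNReal.ofReal_pow (Real.exp_pos _).le, ← Real.exp_nat_mul,
              ← ENNReal.ofReal_mul (Real.exp_pos _).le, ← Real.exp_add]
  calc _ ≤ ∫⁻ _, ENNReal.ofReal (Real.exp (-(θ * t) + n * r)) ∂(Measure.pi fun i => P.map (W i)) :=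
        lintegral_mono hslice
    _ = _ := by simp

end Ordered

/-! ### Norms and the deterministic Lasso bound. -/

section Norms

variable {p : ℕ}

theorem lqNorm_one (v : Fin p → ℝ) : lqNorm 1 v = ∑ j, |v j| := by simp [lqNorm]

theorem lqNorm_two (v : Fin p → ℝ) : lqNorm 2 v = √(∑ j, v j ^ 2) := by
  simp [lqNorm, Real.sqrt_eq_rpow]

theorem lqNorm_two_sq (v : Fin p → ℝ) : lqNorm 2 v ^ 2 = ∑ j, v j ^ 2 := by
  rw [lqNorm_two, Real.sq_sqrt (Finset.sum_nonneg fun _ _ => sq_nonneg _)]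

theorem lqNorm_two_nonneg (v : Fin p → ℝ) : 0 ≤ lqNorm 2 v := by
  rw [lqNorm_two]; positivity

theorem lqNorm_two_single (j : Fin p) : lqNorm 2 (Pi.single j (1 : ℝ)) = 1 := by
  rw [lqNorm_two, Finset.sum_eq_single j]
  · simp
  · intro i _ hi
    simp [Pi.single_eq_of_ne hi]
  · simp

theorem lqNorm_two_smul (c : ℝ) (v : Fin p → ℝ) : lqNorm 2 (c • v) = |c| * lqNorm 2 v := by
  rw [lqNorm_two, lqNorm_two, ← Real.sqrt_sq_eq_abs, ← Real.sqrt_mul (sq_nonneg c),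
    Finset.mul_sum]
  simp [mul_pow]

theorem lqNorm_two_eq_zero {v : Fin p → ℝ} (h : lqNorm 2 v = 0) : v = 0 := by
  have h1 := lqNorm_two_sq v
  rw [h, zero_pow two_ne_zero, eq_comm,
    Finset.sum_eq_zero_iff_of_nonneg fun _ _ => sq_nonneg _] at h1
  ext j
  simpa using h1 j (Finset.mem_univ j)

theorem lqNorm_two_inv_smul {v : Fin p → ℝ} (hv : v ≠ 0) :
    lqNorm 2 ((lqNorm 2 v)⁻¹ • v) = 1 := by
  have h0 : lqNorm 2 v ≠ 0 := fun h => hv (lqNorm_two_eq_zero h)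
  rw [lqNorm_two_smul, abs_of_nonneg (inv_nonneg.2 (lqNorm_two_nonneg v)), inv_mul_cancel₀ h0]

/-- Error bounds for the Lasso, from a bound on the gradient at `b₀` and a lower bound on the
quadratic form of the design on the cone of approximately sparse vectors. -/
theorem lqNorm_lasso_sub_le {n : ℕ} {I : Finset (Fin n)} {x : Fin n → Fin p → ℝ} {y : Fin n → ℝ}
    {b b₀ : Fin p → ℝ} {c l a : ℝ} {s : ℕ} (hc : 0 ≤ c) (hl : 0 < l) (ha : 0 < a)
    (hmin : c * ∑ i ∈ I, (y i - x i ⬝ᵥ b) ^ 2 + l * lqNorm 1 b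
      ≤ c * ∑ i ∈ I, (y i - x i ⬝ᵥ b₀) ^ 2 + l * lqNorm 1 b₀)
    (hgrad : ∀ j, |c * ∑ i ∈ I, (y i - x i ⬝ᵥ b₀) * x i j| ≤ l / 4)
    (hs : {j | b₀ j ≠ 0}.ncard ≤ s)
    (hRE : ∀ v : Fin p → ℝ, (∑ j, |v j|) ^ 2 ≤ 16 * s * ∑ j, v j ^ 2 →
      a * ∑ j, v j ^ 2 ≤ c * ∑ i ∈ I, (x i ⬝ᵥ v) ^ 2)
    {q : ℕ} (hq : q = 1 ∨ q = 2) :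
    lqNorm q (b - b₀) ≤ 8 * (l / a) * (s : ℝ) ^ (1 / (q : ℝ)) := by
  classical
  set v := b - b₀ with hv
  set S : Finset (Fin p) := Finset.univ.filter fun j => b₀ j ≠ 0 with hS
  have hScard : (S.card : ℝ) ≤ s := by
    have : S.card ≤ s := by
      rw [← Set.ncard_coe_finset]
      simpa [hS] using hs
    exact_mod_cast this
  set N := ∑ j, |v j| with hN
  set N₁ := ∑ j ∈ S, |v j| with hN₁
  set V := ∑ j, v j ^ 2 with hV
  have hexpand : c * ∑ i ∈ I, (y i - x i ⬝ᵥ b) ^ 2 = c * ∑ i ∈ I, (y i - x i ⬝ᵥ b₀) ^ 2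
      - 2 * ∑ j, (c * ∑ i ∈ I, (y i - x i ⬝ᵥ b₀) * x i j) * v j
      + c * ∑ i ∈ I, (x i ⬝ᵥ v) ^ 2 := by
    have h1 : ∑ j, (c * ∑ i ∈ I, (y i - x i ⬝ᵥ b₀) * x i j) * v j
        = c * ∑ i ∈ I, (y i - x i ⬝ᵥ b₀) * (x i ⬝ᵥ v) := by
      simp_rw [dotProduct, mul_assoc, Finset.sum_mul, Finset.mul_sum]
      rw [Finset.sum_comm]
      simp_rw [mul_assoc]
    have h2 : ∀ i, x i ⬝ᵥ b = x i ⬝ᵥ b₀ + x i ⬝ᵥ v := fun i => by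
      rw [← dotProduct_add]; simp [hv]
    rw [h1]
    simp_rw [h2, Finset.mul_sum, ← Finset.sum_sub_distrib, ← Finset.sum_add_distrib]
    exact Finset.sum_congr rfl fun i _ => by ring
  have hlin : ∑ j, (c * ∑ i ∈ I, (y i - x i ⬝ᵥ b₀) * x i j) * v j ≤ l / 4 * N := by
    rw [hN, Finset.mul_sum]
    refine Finset.sum_le_sum fun j _ => ?_
    calc _ ≤ |(c * ∑ i ∈ I, (y i - x i ⬝ᵥ b₀) * x i j) * v j| := le_abs_self _
      _ ≤ _ := by
        rw [abs_mul]
        exact mul_le_mul_of_nonneg_right (hgrad j) (abs_nonneg _)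
  have hpen : lqNorm 1 b₀ - lqNorm 1 b ≤ 2 * N₁ - N := by
    rw [lqNorm_one, lqNorm_one, ← Finset.sum_sub_distrib, hN₁, hS, Finset.sum_filter, hN,
      Finset.mul_sum, ← Finset.sum_sub_distrib]
    refine Finset.sum_le_sum fun j _ => ?_
    simp only [hv, Pi.sub_apply]
    by_cases h : b₀ j = 0
    · simp [h]
    · simp only [h, ne_eq, not_false_eq_true, if_true]
      have := abs_sub_abs_le_abs_sub (b₀ j) (b j)
      rw [abs_sub_comm] at this
      linarith
  -- The linear term costs `2 (l/4) N` and the penalty gains `l (2N₁ - N)`. This inequality yields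
  -- both the cone condition and the size of the error.
  have hbasic : c * ∑ i ∈ I, (x i ⬝ᵥ v) ^ 2 ≤ 2 * l * N₁ - l / 2 * N := by
    rw [hexpand] at hmin
    nlinarith
  have hV0 : 0 ≤ V := Finset.sum_nonneg fun _ _ => sq_nonneg _
  have hN0 : 0 ≤ N := Finset.sum_nonneg fun _ _ => abs_nonneg _
  have hN₁0 : 0 ≤ N₁ := Finset.sum_nonneg fun _ _ => abs_nonneg _
  have hCS : N₁ ^ 2 ≤ s * V := by
    calc N₁ ^ 2 ≤ S.card * ∑ j ∈ S, |v j| ^ 2 := sq_sum_le_card_mul_sum_sq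
      _ ≤ S.card * V := by
        gcongr
        simp_rw [sq_abs]
        exact Finset.sum_le_univ_sum_of_nonneg fun _ => sq_nonneg _
      _ ≤ s * V := by gcongr
  -- Outside the cone the basic inequality would make a sum of squares negative. Inside it, `N² ≤ 16
  -- N₁² ≤ 16 s V`.
  by_cases hcone : N ≤ 4 * N₁
  · have hN2 : N ^ 2 ≤ 16 * s * V := by nlinarith
    have hre := hRE v hN2
    have hsq : a * V ≤ 2 * l * N₁ := by
      have : 0 ≤ l / 2 * N := by positivity
      linarith
    have hs0 : (0 : ℝ) ≤ s := Nat.cast_nonneg s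
    have hN₁s : N₁ ≤ √s * √V := by
      rw [← Real.sqrt_mul hs0]
      exact Real.le_sqrt_of_sq_le hCS
    have hV2 : √V ≤ 2 * (l / a) * √s := by
      rcases eq_or_lt_of_le (Real.sqrt_nonneg V) with h0 | h0
      · rw [← h0]; positivity
      · have h1 : a * √V ^ 2 ≤ 2 * l * (√s * √V) := by
          rw [Real.sq_sqrt hV0]
          exact hsq.trans (by gcongr)
        have h2 : a * √V ≤ 2 * l * √s := by
          by_contra hne
          push Not at hne
          nlinarith
        rw [show 2 * (l / a) * √s = (2 * l * √s) / a by ring, le_div_iff₀ ha]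
        linarith
    rcases hq with rfl | rfl
    · rw [lqNorm_one]
      simp only [Nat.cast_one, div_one, Real.rpow_one]
      calc N ≤ 4 * (√s * √V) := by linarith
        _ ≤ 4 * (√s * (2 * (l / a) * √s)) := by gcongr
        _ = 8 * (l / a) * (√s * √s) := by ring
        _ = _ := by rw [Real.mul_self_sqrt hs0]
    · rw [lqNorm_two]
      simp only [Nat.cast_ofNat, ← Real.sqrt_eq_rpow]
      refine hV2.trans ?_
      have : 0 ≤ l / a * √s := by positivity
      linarith
  · exfalso
    push Not at hcone
    have hzero : c * ∑ i ∈ I, (x i ⬝ᵥ v) ^ 2 < 0 := by nlinarith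
    have : 0 ≤ c * ∑ i ∈ I, (x i ⬝ᵥ v) ^ 2 := by positivity
    linarith

end Norms

/-! ### Auxiliary facts on eigenvalues, independence and union bounds. -/

/-- The quadratic form of a symmetric matrix is bounded below by its least eigenvalue. -/
theorem mul_sum_sq_le_of_hasEigenvalue {p : ℕ} {A : Matrix (Fin p) (Fin p) ℝ} (hA : A.IsHermitian)
    {κ : ℝ} (h : ∀ a : ℝ, Module.End.HasEigenvalue (Matrix.toLin' A) a → κ ≤ a)
    (v : Fin p → ℝ) : κ * ∑ j, v j ^ 2 ≤ v ⬝ᵥ (A *ᵥ v) := by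
  have hB : (A - κ • (1 : Matrix (Fin p) (Fin p) ℝ)).IsHermitian :=
    hA.sub (by simp [Matrix.IsHermitian])
  have hpsd : (A - κ • (1 : Matrix (Fin p) (Fin p) ℝ)).PosSemidef := by
    rw [hB.posSemidef_iff_eigenvalues_nonneg]
    intro i
    have hv := hB.mulVec_eigenvectorBasis i
    have hne : (hB.eigenvectorBasis i).ofLp ≠ 0 := by
      intro h0
      exact hB.eigenvectorBasis.orthonormal.ne_zero i (by ext j; exact congrFun h0 j)
    have : Module.End.HasEigenvalue (Matrix.toLin' A) (hB.eigenvalues i + κ) := by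
      refine Module.End.hasEigenvalue_of_hasEigenvector (x := (hB.eigenvectorBasis i).ofLp)
        (Module.End.hasEigenvector_iff.2 ⟨?_, hne⟩)
      rw [Module.End.mem_eigenspace_iff, Matrix.toLin'_apply, add_smul, ← hv, Matrix.sub_mulVec,
        Matrix.smul_mulVec, Matrix.one_mulVec]
      simp
    have := h _ this
    simp only [Pi.zero_apply]
    linarith
  have := hpsd.dotProduct_mulVec_nonneg v
  rw [Matrix.sub_mulVec, Matrix.smul_mulVec, Matrix.one_mulVec, dotProduct_sub, dotProduct_smul]
    at this
  have hvv : v ⬝ᵥ v = ∑ j, v j ^ 2 := by simp [dotProduct, sq]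
  simp only [star_trivial, hvv, smul_eq_mul] at this
  linarith

section General

variable {Ω : Type*} [MeasurableSpace Ω] {P : Measure Ω} [IsProbabilityMeasure P]

/-- Jensen's inequality through `exp z ≥ 1 + z`. It supplies the submartingale condition required by
the maximal inequality. -/
theorem one_le_lintegral_exp_of_integral_eq_zero {Z : Ω → ℝ} (hZ : Integrable Z P)
    (h0 : ∫ ω, Z ω ∂P = 0) (θ : ℝ) :
    1 ≤ ∫⁻ ω, ENNReal.ofReal (Real.exp (θ * Z ω)) ∂P := by
  by_cases htop : ∫⁻ ω, ENNReal.ofReal (Real.exp (θ * Z ω)) ∂P = ⊤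
  · rw [htop]; exact le_top
  have hint : Integrable (fun ω => Real.exp (θ * Z ω)) P := by
    refine ⟨(Real.continuous_exp.comp_aestronglyMeasurable (hZ.1.const_mul θ)), ?_⟩
    rw [hasFiniteIntegral_iff_ofReal (ae_of_all _ fun _ => (Real.exp_pos _).le)]
    exact lt_of_le_of_ne le_top htop
  rw [← ofReal_integral_eq_lintegral_ofReal hint (ae_of_all _ fun _ => (Real.exp_pos _).le),
    ENNReal.one_le_ofReal]
  calc (1 : ℝ) = ∫ ω, (θ * Z ω + 1) ∂P := by
        rw [integral_add (hZ.const_mul θ) (integrable_const 1), integral_const_mul, h0]; simp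
    _ ≤ _ := integral_mono ((hZ.const_mul θ).add (integrable_const 1)) hint
        fun ω => Real.add_one_le_exp _

/-- The hypotheses make the law of the triple a product, which may be regrouped. It is used to make
`w_i` independent of the pair `(x_i, ε_i)`. -/
theorem ProbabilityTheory.IndepFun.prodMk_swap {𝓧 𝓨 𝓩 : Type*} [MeasurableSpace 𝓧]
    [MeasurableSpace 𝓨] [MeasurableSpace 𝓩] {X : Ω → 𝓧} {Y : Ω → 𝓨} {Z : Ω → 𝓩}
    (mX : Measurable X) (mY : Measurable Y) (mZ : Measurable Z)
    (h1 : IndepFun X (fun ω => (Y ω, Z ω)) P) (h2 : IndepFun Y Z P) :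
    IndepFun Y (fun ω => (X ω, Z ω)) P := by
  have : IsProbabilityMeasure (P.map X) := Measure.isProbabilityMeasure_map mX.aemeasurable
  have : IsProbabilityMeasure (P.map Y) := Measure.isProbabilityMeasure_map mY.aemeasurable
  have : IsProbabilityMeasure (P.map Z) := Measure.isProbabilityMeasure_map mZ.aemeasurable
  have hXZ : IndepFun X Z P := h1.comp (φ := id) (ψ := Prod.snd) measurable_id measurable_snd
  refine IndepFun.symm ?_
  rw [indepFun_iff_map_prod_eq_prod_map_map (mX.prodMk mZ).aemeasurable mY.aemeasurable,
    (indepFun_iff_map_prod_eq_prod_map_map mX.aemeasurable mZ.aemeasurable).1 hXZ]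
  have e1 := (indepFun_iff_map_prod_eq_prod_map_map mX.aemeasurable
    (mY.prodMk mZ).aemeasurable).1 h1
  rw [(indepFun_iff_map_prod_eq_prod_map_map mY.aemeasurable mZ.aemeasurable).1 h2] at e1
  have e2 : (P.map X).prod ((P.map Z).prod (P.map Y)) = P.map (fun ω => (X ω, (Z ω, Y ω))) := by
    rw [← Measure.prod_swap (μ := P.map Y), ← Measure.map_id (μ := P.map X),
      Measure.map_prod_map _ _ measurable_id measurable_swap, ← e1,
      Measure.map_map (measurable_id.prodMap measurable_swap) (by fun_prop)]
    rfl
  have e3 := (measurePreserving_prodAssoc (P.map X) (P.map Z) (P.map Y)).symm.map_eq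
  rw [← e3, e2, Measure.map_map (MeasurableEquiv.measurable _) (by fun_prop)]
  rfl

/-- A union over `k` signed basis vectors has `(2p)^k ≤ p^(2k)` members, so an exponent of `(2k + 1)
log p` leaves `1 / p`. -/
theorem two_mul_pow_mul_exp_le {p k : ℕ} (hp : 2 ≤ p) {c : ℝ}
    (hc : (2 * k + 1) * Real.log p ≤ c) :
    (((p * 2) ^ k : ℕ) : ℝ) * Real.exp (-c) ≤ Real.exp (-Real.log p) := by
  have hp0 : (0 : ℝ) < p := by positivity
  have h1 : (((p * 2) ^ k : ℕ) : ℝ) ≤ Real.exp (2 * k * Real.log p) := by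
    have : Real.exp (2 * k * Real.log p) = ((p * p) ^ k : ℝ) := by
      rw [← sq, ← pow_mul, ← Real.exp_log (pow_pos hp0 _), Real.log_pow]
      push_cast; rfl
    rw [this]
    push_cast
    have : (2 : ℝ) ≤ p := by exact_mod_cast hp
    gcongr
  calc _ ≤ Real.exp (2 * k * Real.log p) * Real.exp (-c) := by gcongr
    _ = Real.exp (2 * k * Real.log p - c) := by rw [← Real.exp_add]; rfl
    _ ≤ _ := Real.exp_le_exp.2 (by linarith)

end General

/-! ### The random design: restricted eigenvalues and window sums. -/

namespace ChangePointModel.Distribution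

variable {n p : ℕ} {M : ChangePointModel.{u} n p} {σx σε : ℝ≥0} {κ φ : ℝ}

theorem iIndepFun_x_w (h : M.Distribution σx σε κ φ) :
    iIndepFun (fun i ω => (M.x i ω, M.w i ω)) M.P :=
  h.indep_obs.comp (fun _ z => (z.1, z.2.1)) fun _ => by fun_prop

theorem indepFun_x_w (h : M.Distribution σx σε κ φ) (i : Fin n) :
    IndepFun (M.x i) (M.w i) M.P :=
  (h.indep_x i).comp (φ := id) (ψ := Prod.fst) measurable_id measurable_fst

theorem indepFun_x_ε (h : M.Distribution σx σε κ φ) (i : Fin n) :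
    IndepFun (M.x i) (M.ε i) M.P :=
  (h.indep_x i).comp (φ := id) (ψ := Prod.snd) measurable_id measurable_snd

end ChangePointModel.Distribution

theorem measurable_dotProduct_const {p : ℕ} (v : Fin p → ℝ) :
    Measurable fun x : Fin p → ℝ => x ⬝ᵥ v := by
  unfold dotProduct
  fun_prop

namespace ChangePointModel.Distribution

variable {n p : ℕ} {M : ChangePointModel.{u} n p} {σx σε : ℝ≥0} {κ φ : ℝ}

theorem measurable_x_dotProduct (M : ChangePointModel.{u} n p) (i : Fin n) (v : Fin p → ℝ) :
    Measurable fun ω => M.x i ω ⬝ᵥ v :=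
  (measurable_dotProduct_const v).comp (M.measurable_x i)

theorem hasSubgaussianMGF_x_apply (h : M.Distribution σx σε κ φ) (i : Fin n) (j : Fin p) :
    HasSubgaussianMGF (fun ω => M.x i ω j) (σx ^ 2) M.P := by
  simpa using h.x_subgaussian i _ (lqNorm_two_single j)

theorem lintegral_exp_dotProduct_sq_le (h : M.Distribution σx σε κ φ) (i : Fin n)
    {v : Fin p → ℝ} (hv : lqNorm 2 v = 1) {A : ℝ} (hA : 0 < A) (hσ : (σx : ℝ) ^ 2 ≤ A) :
    ∫⁻ ω, ENNReal.ofReal (Real.exp ((M.x i ω ⬝ᵥ v) ^ 2 / (4 * A))) ∂M.P ≤ 2 :=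
  (h.x_subgaussian i v hv).lintegral_exp_sq_le (measurable_x_dotProduct M i v) hA
    (by simpa using hσ)

theorem le_integral_dotProduct_sq (h : M.Distribution σx σε κ φ) (i : Fin n)
    {v : Fin p → ℝ} (hv : lqNorm 2 v = 1) : κ ≤ ∫ ω, (M.x i ω ⬝ᵥ v) ^ 2 ∂M.P := by
  have hsymm : (M.covX i).IsHermitian := by
    ext j k
    simp [covX, mul_comm]
  have h1 := mul_sum_sq_le_of_hasEigenvalue hsymm (fun a ha => (h.x_eigenvalue i a ha).1) v
  rw [← lqNorm_two_sq, hv, one_pow, mul_one] at h1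
  refine h1.trans (le_of_eq ?_)
  have hm : ∀ j, MemLp (fun ω => M.x i ω j) 2 M.P := fun j =>
    (h.hasSubgaussianMGF_x_apply i j).memLp 2
  have hint : ∀ j k, Integrable (fun ω => M.x i ω j * M.x i ω k) M.P := fun j k =>
    (hm j).integrable_mul (hm k)
  have h2 : ∀ ω, (M.x i ω ⬝ᵥ v) ^ 2 = ∑ j, ∑ k, v j * v k * (M.x i ω j * M.x i ω k) := by
    intro ω
    rw [sq, dotProduct, Finset.sum_mul_sum]
    exact Finset.sum_congr rfl fun j _ => Finset.sum_congr rfl fun k _ => by ring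
  simp_rw [h2]
  rw [integral_finsetSum _ fun j _ => integrable_finsetSum _ fun k _ => (hint j k).const_mul _]
  simp_rw [dotProduct, Matrix.mulVec, dotProduct, covX, Matrix.of_apply, Finset.mul_sum]
  refine Finset.sum_congr rfl fun j _ => ?_
  rw [integral_finsetSum _ fun k _ => (hint j k).const_mul _]
  refine Finset.sum_congr rfl fun k _ => ?_
  rw [integral_const_mul]
  ring

/-- Lower tail of the quadratic form of the design in a fixed direction. -/
theorem measure_sum_sq_le_le (h : M.Distribution σx σε κ φ) {A κ' : ℝ} (hκ' : 0 < κ')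
    (hκ : κ' ≤ κ) (hκA : κ' ≤ A) (hσ : (σx : ℝ) ^ 2 ≤ A) {S : Set ℝ} (mS : MeasurableSet S)
    {v : Fin p → ℝ} (hv : v ≠ 0) :
    M.P {ω | ∑ i, S.indicator (fun _ => (1 : ℝ)) (M.w i ω) * (M.x i ω ⬝ᵥ v) ^ 2
        ≤ n * M.lawW.real S * (κ' / 4) * ∑ j, v j ^ 2}
      ≤ ENNReal.ofReal (Real.exp (-(n * M.lawW.real S * (κ' ^ 2 / (256 * A ^ 2))))) := by
  have hA : 0 < A := hκ'.trans_le hκA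
  -- This `θ` minimizes `1 - θκ' + 32θ²A²`, at `1 - κ'²/(128A²)`. The level `κ'/4` costs half of
  -- that gain, leaving `κ'²/(256A²)`.
  set θ := κ' / (64 * A ^ 2) with hθ
  have hθ0 : 0 < θ := by positivity
  set N := lqNorm 2 v with hN
  have hN0 : 0 < N := lt_of_le_of_ne (lqNorm_two_nonneg v) fun h0 =>
    hv (lqNorm_two_eq_zero h0.symm)
  have hunit := lqNorm_two_inv_smul hv
  have hBeq : 1 - θ * κ' + 32 * θ ^ 2 * A ^ 2 = 1 - κ' ^ 2 / (128 * A ^ 2) := by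
    rw [hθ]; field_simp; ring
  have hB0 : 0 ≤ 1 - κ' ^ 2 / (128 * A ^ 2) := by
    rw [sub_nonneg, div_le_one (by positivity)]
    nlinarith
  have key := measure_sum_indicator_ge_le M.measurable_w M.measurable_x h.iIndepFun_x_w
    h.indepFun_x_w h.w_law (f := fun x => -θ * (x ⬝ᵥ (N⁻¹ • v)) ^ 2)
    (((measurable_dotProduct_const _).pow_const 2).const_mul (-θ)) mS hB0
    (fun i => by
      rw [← hBeq]
      exact (h.x_subgaussian i _ hunit).lintegral_exp_neg_sq_le (measurable_x_dotProduct M i _) hA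
        (by simpa using hσ) hθ0.le (hκ.trans (h.le_integral_dotProduct_sq i hunit)))
    (-θ * (n * M.lawW.real S * (κ' / 4)))
  refine le_trans (measure_mono ?_) (key.trans (ENNReal.ofReal_le_ofReal (Real.exp_le_exp.2 ?_)))
  · intro ω hω
    simp only [Set.mem_ofPred_eq] at hω ⊢
    rw [← lqNorm_two_sq, ← hN] at hω
    have h1 : ∑ i, S.indicator (fun _ => (1 : ℝ)) (M.w i ω) *
        (-θ * (M.x i ω ⬝ᵥ (N⁻¹ • v)) ^ 2)
        = -θ * ((∑ i, S.indicator (fun _ => (1 : ℝ)) (M.w i ω) * (M.x i ω ⬝ᵥ v) ^ 2) / N ^ 2) := by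
      rw [Finset.sum_div, Finset.mul_sum]
      refine Finset.sum_congr rfl fun i _ => ?_
      rw [dotProduct_smul, smul_eq_mul, mul_pow, inv_pow]
      ring
    rw [h1]
    refine mul_le_mul_of_nonpos_left ?_ (by linarith)
    rwa [div_le_iff₀ (by positivity)]
  · refine le_of_eq ?_
    rw [hθ]; field_simp; ring

/-- Chernoff's bound with exponential moment `2` at twice the expected count. It bounds the diagonal
of the form, the quantity `D` in Maurey's argument. -/
theorem measure_sum_sq_apply_ge_le (h : M.Distribution σx σε κ φ) {A : ℝ} (hA : 0 < A)
    (hσ : (σx : ℝ) ^ 2 ≤ A) {S : Set ℝ} (mS : MeasurableSet S) (j : Fin p) :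
    M.P {ω | 8 * A * (n * M.lawW.real S)
        ≤ ∑ i, S.indicator (fun _ => (1 : ℝ)) (M.w i ω) * M.x i ω j ^ 2}
      ≤ ENNReal.ofReal (Real.exp (-(n * M.lawW.real S))) := by
  have key := measure_sum_indicator_ge_le M.measurable_w M.measurable_x h.iIndepFun_x_w
    h.indepFun_x_w h.w_law (f := fun x => x j ^ 2 / (4 * A)) (by fun_prop) mS (B := 2) (by norm_num)
    (fun i => by simpa using h.lintegral_exp_dotProduct_sq_le i (lqNorm_two_single j) hA hσ)
    (2 * (n * M.lawW.real S))
  refine le_trans (measure_mono ?_) (key.trans (ENNReal.ofReal_le_ofReal (Real.exp_le_exp.2 ?_)))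
  · intro ω hω
    simp only [Set.mem_ofPred_eq] at hω ⊢
    simp_rw [← mul_div_assoc]
    rw [← Finset.sum_div, le_div_iff₀ (by positivity)]
    linarith
  · linarith

end ChangePointModel.Distribution

/-- Maurey's argument for the design form minus `d ‖·‖₂²`. Subtracting only lowers the diagonal, so
the column bounds `D` still apply. -/
theorem le_weighted_sum_sq_of_sparse {n p k : ℕ} (hk : 1 ≤ k) (c : Fin n → ℝ)
    (x : Fin n → Fin p → ℝ) {d D : ℝ} (hd : 0 ≤ d)
    (h : ∀ f : Fin k → Fin p × Bool,
      d * ∑ j, (∑ l, Pi.single (f l).1 (if (f l).2 then (1 : ℝ) else -1) : Fin p → ℝ) j ^ 2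
        ≤ ∑ i, c i * (x i ⬝ᵥ ∑ l, Pi.single (f l).1 (if (f l).2 then (1 : ℝ) else -1)) ^ 2)
    (hD : ∀ j, ∑ i, c i * x i j ^ 2 ≤ D) (v : Fin p → ℝ) :
    -((∑ j, |v j|) ^ 2 * D) ≤ (k - 1) * (∑ i, c i * (x i ⬝ᵥ v) ^ 2 - d * ∑ j, v j ^ 2) := by
  let B : LinearMap.BilinForm ℝ (Fin p → ℝ) := LinearMap.mk₂ ℝ
    (fun u v => ∑ i, c i * ((x i ⬝ᵥ u) * (x i ⬝ᵥ v)) - d * (u ⬝ᵥ v))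
    (fun u u' v => by
      simp only [dotProduct_add, add_dotProduct, add_mul, mul_add, Finset.sum_add_distrib]; ring)
    (fun r u v => by
      simp only [dotProduct_smul, smul_dotProduct, smul_eq_mul, mul_sub, Finset.mul_sum]
      congr 1
      · exact Finset.sum_congr rfl fun _ _ => by ring
      · ring)
    (fun u u' v => by
      simp only [dotProduct_add, mul_add, Finset.sum_add_distrib]; ring)
    (fun r u v => by
      simp only [dotProduct_smul, smul_eq_mul, mul_sub, Finset.mul_sum]
      congr 1
      · exact Finset.sum_congr rfl fun _ _ => by ring
      · ring)
  have hB : ∀ v, B v v = ∑ i, c i * (x i ⬝ᵥ v) ^ 2 - d * ∑ j, v j ^ 2 := by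
    intro v
    simp only [B, LinearMap.mk₂_apply, sq]
    rfl
  have key := neg_sq_sum_abs_mul_le_bilinForm B hk (fun f => by rw [hB]; linarith [h f]) (D := D)
    (fun j => by
      rw [hB]
      have h1 : 0 ≤ d * ∑ l, (Pi.single j (1 : ℝ) : Fin p → ℝ) l ^ 2 := by positivity
      have h2 := hD j
      simp only [dotProduct_single_one]
      linarith) v
  rwa [hB] at key

namespace ChangePointModel.Distribution

variable {n p : ℕ} {M : ChangePointModel.{u} n p} {σx σε : ℝ≥0} {κ φ : ℝ}

/-- The restricted eigenvalue condition for the observations with `w i ∈ S`. -/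
theorem measure_not_restricted_eigenvalue_le (h : M.Distribution σx σε κ φ) {A κ' : ℝ}
    (hκ' : 0 < κ') (hκ : κ' ≤ κ) (hκA : κ' ≤ A) (hσ : (σx : ℝ) ^ 2 ≤ A) (hp : 2 ≤ p) {s : ℕ}
    (hs : 1 ≤ s) {K : ℕ} (hK : 1024 * A / κ' ≤ K) {S : Set ℝ} (mS : MeasurableSet S)
    (hsn : (2 * K + 3) * (s * Real.log p)
      ≤ κ' ^ 2 / (256 * A ^ 2) * (n * M.lawW.real S)) :
    M.P {ω | ¬ ∀ v : Fin p → ℝ, (∑ j, |v j|) ^ 2 ≤ 16 * s * ∑ j, v j ^ 2 →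
        M.lawW.real S * (κ' / 8) * ∑ j, v j ^ 2
          ≤ 1 / (n : ℝ) * ∑ i, S.indicator (fun _ => (1 : ℝ)) (M.w i ω) * (M.x i ω ⬝ᵥ v) ^ 2}
      ≤ ENNReal.ofReal (2 * Real.exp (-Real.log p)) := by
  have hA : 0 < A := hκ'.trans_le hκA
  set ρ := κ' ^ 2 / (256 * A ^ 2) with hρ
  have hρ0 : 0 < ρ := by positivity
  have hρ1 : ρ ≤ 1 := by
    rw [hρ, div_le_one (by positivity)]
    nlinarith
  set m := n * M.lawW.real S with hm
  have hlog : 0 < Real.log p := Real.log_pos (by exact_mod_cast hp)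
  have hs1 : (1 : ℝ) ≤ s := by exact_mod_cast hs
  have hm0 : 0 < m := by
    have : 0 < (2 * (K : ℝ) + 3) * (s * Real.log p) := by positivity
    by_contra hneg
    nlinarith
  have hn0 : (0 : ℝ) < n := by
    by_contra hneg
    have : (n : ℝ) = 0 := le_antisymm (not_lt.1 hneg) (Nat.cast_nonneg n)
    rw [hm, this, zero_mul] at hm0
    exact lt_irrefl _ hm0
  -- So `k - 1 = K s`. On the cone the Maurey defect is at most `16 s V · 8Am / (K s) ≤ m (κ'/8) V`,
  -- which lowers `κ'/4` to `κ'/8`.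
  set k := K * s + 1 with hk
  let z : (Fin k → Fin p × Bool) → Fin p → ℝ := fun f =>
    ∑ l, Pi.single (f l).1 (if (f l).2 then (1 : ℝ) else -1)
  set Q : M.Ω → (Fin p → ℝ) → ℝ := fun ω v =>
    ∑ i, S.indicator (fun _ => (1 : ℝ)) (M.w i ω) * (M.x i ω ⬝ᵥ v) ^ 2 with hQ
  -- Opposite signs may cancel to give `z f = 0`; there the lower bound is trivial but the tail
  -- estimate does not apply.
  set E₁ : (Fin k → Fin p × Bool) → Set M.Ω := fun f =>
    {ω | z f ≠ 0 ∧ Q ω (z f) ≤ m * (κ' / 4) * ∑ j, z f j ^ 2} with hE₁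
  set E₂ : Fin p → Set M.Ω := fun j =>
    {ω | 8 * A * m ≤ ∑ i, S.indicator (fun _ => (1 : ℝ)) (M.w i ω) * M.x i ω j ^ 2} with hE₂
  have hsub : {ω | ¬ ∀ v : Fin p → ℝ, (∑ j, |v j|) ^ 2 ≤ 16 * s * ∑ j, v j ^ 2 →
        M.lawW.real S * (κ' / 8) * ∑ j, v j ^ 2 ≤ 1 / (n : ℝ) * Q ω v}
      ⊆ (⋃ f, E₁ f) ∪ ⋃ j, E₂ j := by
    intro ω hω
    by_contra hno
    simp only [Set.mem_union, Set.mem_iUnion, not_or, not_exists, hE₁, hE₂, Set.mem_ofPred_eq,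
      not_and, not_le] at hno
    obtain ⟨h1, h2⟩ := hno
    refine hω fun v hv => ?_
    have key := le_weighted_sum_sq_of_sparse (k := k) (by omega)
      (fun i => S.indicator (fun _ => (1 : ℝ)) (M.w i ω)) (fun i => M.x i ω)
      (d := m * (κ' / 4)) (D := 8 * A * m) (by positivity)
      (fun f => by
        rcases eq_or_ne (z f) 0 with h0 | h0
        · simp only [z] at h0
          rw [h0]
          simp
        · exact (h1 f h0).le)
      (fun j => (h2 j).le) v
    have hk1 : ((k : ℕ) : ℝ) - 1 = K * s := by rw [hk]; push_cast; ring
    rw [hk1] at key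
    change _ ≤ K * s * (Q ω v - _) at key
    set V := ∑ j, v j ^ 2 with hV
    have hV0 : 0 ≤ V := Finset.sum_nonneg fun _ _ => sq_nonneg _
    have hK1 : 1024 * A ≤ K * κ' := (div_le_iff₀ hκ').1 hK
    have hK0 : (0 : ℝ) < K := lt_of_lt_of_le (by positivity) hK
    have h3 : -(16 * s * V * (8 * A * m)) ≤ K * s * (Q ω v - m * (κ' / 4) * V) := by
      refine le_trans (neg_le_neg ?_) key
      gcongr
    have h4 : 16 * s * V * (8 * A * m) ≤ K * s * (m * (κ' / 8) * V) := by
      have : 0 ≤ s * V * m := by positivity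
      nlinarith
    have h5 : 0 ≤ K * s * (Q ω v - m * (κ' / 8) * V) := by nlinarith
    have h6 : 0 ≤ Q ω v - m * (κ' / 8) * V := nonneg_of_mul_nonneg_right h5 (by positivity)
    rw [one_div, ← div_eq_inv_mul, le_div_iff₀ hn0]
    rw [hm] at h6
    linarith
  have hE₁le : ∀ f, M.P (E₁ f) ≤ ENNReal.ofReal (Real.exp (-(ρ * m))) := by
    intro f
    rcases eq_or_ne (z f) 0 with h0 | h0
    · simp [hE₁, h0]
    · refine le_trans (measure_mono fun ω hω => hω.2)
        ((h.measure_sum_sq_le_le hκ' hκ hκA hσ mS h0).trans (le_of_eq ?_))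
      rw [mul_comm ρ]
  have hE₂le : ∀ j, M.P (E₂ j) ≤ ENNReal.ofReal (Real.exp (-(ρ * m))) := by
    intro j
    refine (h.measure_sum_sq_apply_ge_le hA hσ mS j).trans
      (ENNReal.ofReal_le_ofReal (Real.exp_le_exp.2 ?_))
    nlinarith
  have hU₁ : M.P (⋃ f, E₁ f) ≤ ENNReal.ofReal (Real.exp (-Real.log p)) := by
    refine (measure_iUnion_fintype_le _ _).trans
      ((Finset.sum_le_sum fun f _ => hE₁le f).trans ?_)
    rw [Finset.sum_const, nsmul_eq_mul, Finset.card_univ, Fintype.card_fun, Fintype.card_prod,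
      Fintype.card_bool, Fintype.card_fin, Fintype.card_fin, ← ENNReal.ofReal_natCast,
      ← ENNReal.ofReal_mul (Nat.cast_nonneg _)]
    refine ENNReal.ofReal_le_ofReal (two_mul_pow_mul_exp_le hp (le_trans ?_ hsn))
    rw [hk]; push_cast
    have : (1 : ℝ) * Real.log p ≤ s * Real.log p := by gcongr
    nlinarith
  have hU₂ : M.P (⋃ j, E₂ j) ≤ ENNReal.ofReal (Real.exp (-Real.log p)) := by
    refine (measure_iUnion_fintype_le _ _).trans
      ((Finset.sum_le_sum fun f _ => hE₂le f).trans ?_)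
    rw [Finset.sum_const, nsmul_eq_mul, Finset.card_univ, Fintype.card_fin,
      ← ENNReal.ofReal_natCast, ← ENNReal.ofReal_mul (Nat.cast_nonneg _)]
    refine ENNReal.ofReal_le_ofReal (le_trans ?_
      (two_mul_pow_mul_exp_le (k := 1) hp (le_trans ?_ hsn)))
    · gcongr
      rw [pow_one]; omega
    · have h1 : (1 : ℝ) * Real.log p ≤ s * Real.log p := by gcongr
      have h2 : 0 ≤ (K : ℝ) * (s * Real.log p) := by positivity
      push_cast
      nlinarith
  refine (measure_mono hsub).trans ((measure_union_le _ _).trans ((add_le_add hU₁ hU₂).trans ?_))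
  rw [← ENNReal.ofReal_add (Real.exp_pos _).le (Real.exp_pos _).le]
  exact ENNReal.ofReal_le_ofReal (by linarith)

/-- A uniform bound for the sums `∑ |x_ij| |x_iᵀδ|` over a window of small probability. -/
theorem measure_not_window_le (h : M.Distribution σx σε κ φ) {A : ℝ} (hA : 0 < A)
    (hσ : (σx : ℝ) ^ 2 ≤ A) (hp : 1 ≤ p) (hn : 1 ≤ n) {J : Set ℝ} (mJ : MeasurableSet J) {t : ℝ}
    (hJ : M.lawW.real J ≤ t) (δ : Fin p → ℝ) :
    M.P {ω | ¬ ∀ j, 1 / (n : ℝ) * ∑ i, J.indicator (fun _ => (1 : ℝ)) (M.w i ω) *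
          (|M.x i ω j| * |M.x i ω ⬝ᵥ δ|)
          ≤ 4 * A * lqNorm 2 δ * (t + 2 * (Real.log p / n))}
      ≤ ENNReal.ofReal (Real.exp (-Real.log p)) := by
  rcases eq_or_ne δ 0 with rfl | hδ
  · have : lqNorm 2 (0 : Fin p → ℝ) = 0 := by simp [lqNorm_two]
    simp [this]
  have hn0 : (0 : ℝ) < n := by exact_mod_cast hn
  have hp0 : (0 : ℝ) < p := by exact_mod_cast hp
  set N := lqNorm 2 δ with hN
  have hN0 : 0 < N := lt_of_le_of_ne (lqNorm_two_nonneg δ) fun h0 =>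
    hδ (lqNorm_two_eq_zero h0.symm)
  have hunit := lqNorm_two_inv_smul hδ
  -- The term `n t` offsets the expected window count, and `2 log p` pays for the union over `p`
  -- coordinates and leaves `1 / p`.
  set E : Fin p → Set M.Ω := fun j => {ω | n * t + 2 * Real.log p
    ≤ ∑ i, J.indicator (fun _ => (1 : ℝ)) (M.w i ω) *
      (|M.x i ω j| * |M.x i ω ⬝ᵥ (N⁻¹ • δ)| / (4 * A))} with hE
  have hEle : ∀ j, M.P (E j) ≤ ENNReal.ofReal (Real.exp (-(2 * Real.log p))) := by
    intro j
    have key := measure_sum_indicator_ge_le M.measurable_w M.measurable_x h.iIndepFun_x_w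
      h.indepFun_x_w h.w_law (f := fun x => |x j| * |x ⬝ᵥ (N⁻¹ • δ)| / (4 * A))
      (((measurable_pi_apply j).abs.mul (measurable_dotProduct_const _).abs).div_const _)
      mJ (B := 2) (by norm_num)
      (fun i => by
        have := lintegral_exp_abs_mul_le (by positivity)
          ((measurable_pi_apply j).comp (M.measurable_x i))
          (by simpa using h.lintegral_exp_dotProduct_sq_le i (lqNorm_two_single j) hA hσ)
          (h.lintegral_exp_dotProduct_sq_le i hunit hA hσ)
        simpa using this)
      (n * t + 2 * Real.log p)
    refine key.trans (ENNReal.ofReal_le_ofReal (Real.exp_le_exp.2 ?_))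
    nlinarith
  have hsub : {ω | ¬ ∀ j, 1 / (n : ℝ) * ∑ i, J.indicator (fun _ => (1 : ℝ)) (M.w i ω) *
        (|M.x i ω j| * |M.x i ω ⬝ᵥ δ|) ≤ 4 * A * N * (t + 2 * (Real.log p / n))} ⊆ ⋃ j, E j := by
    intro ω hω
    by_contra hno
    simp only [Set.mem_iUnion, not_exists, hE, Set.mem_ofPred_eq, not_le] at hno
    refine hω fun j => ?_
    have h1 : ∑ i, J.indicator (fun _ => (1 : ℝ)) (M.w i ω) *
          (|M.x i ω j| * |M.x i ω ⬝ᵥ δ|)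
        = 4 * A * N * ∑ i, J.indicator (fun _ => (1 : ℝ)) (M.w i ω) *
          (|M.x i ω j| * |M.x i ω ⬝ᵥ (N⁻¹ • δ)| / (4 * A)) := by
      rw [Finset.mul_sum]
      refine Finset.sum_congr rfl fun i _ => ?_
      rw [dotProduct_smul, smul_eq_mul, abs_mul, abs_inv, abs_of_pos hN0]
      field_simp
    rw [h1, one_div, ← div_eq_inv_mul, div_le_iff₀ hn0, mul_assoc _ _ (n : ℝ)]
    have h2 : (t + 2 * (Real.log p / n)) * n = n * t + 2 * Real.log p := by field_simp
    rw [h2]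
    have := (hno j).le
    gcongr
  refine (measure_mono hsub).trans ((measure_iUnion_fintype_le _ _).trans
      ((Finset.sum_le_sum fun f _ => hEle f).trans ?_))
  rw [Finset.sum_const, nsmul_eq_mul, Finset.card_univ, Fintype.card_fin,
    ← ENNReal.ofReal_natCast, ← ENNReal.ofReal_mul (Nat.cast_nonneg _)]
  refine ENNReal.ofReal_le_ofReal (le_of_eq ?_)
  nth_rw 1 [← Real.exp_log hp0]
  rw [← Real.exp_add]
  congr 1; ring

end ChangePointModel.Distribution

/-! ### Noise, bias and the Lasso on good events. -/

theorem rate_nonneg (p n : ℕ) : 0 ≤ rate p n := Real.sqrt_nonneg _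

theorem rate_sq (p n : ℕ) : rate p n ^ 2 = Real.log p / n :=
  Real.sq_sqrt (div_nonneg (Real.log_natCast_nonneg p) (Nat.cast_nonneg n))

namespace ChangePointModel

variable {n p : ℕ} {M : ChangePointModel.{u} n p} {σx σε : ℝ≥0} {κ φ : ℝ}

/-- The correlations of the errors with the predictors, uniformly over all partitions. -/
theorem Distribution.measure_not_noise_le (h : M.Distribution σx σε κ φ) {A : ℝ} (hA : 0 < A)
    (hσ : (σx : ℝ) ^ 2 ≤ A) (hp : 2 ≤ p) (hn : 1 ≤ n)
    (hr : 2 * A * (σε : ℝ) ^ 2 * rate p n ^ 2 ≤ 1) :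
    M.P {ω | ¬ ∀ (τ : ℝ) (j : Fin p),
        |1 / (n : ℝ) * ∑ i ∈ Finset.univ.filter (fun i => M.w i ω ≤ τ), M.ε i ω * M.x i ω j|
          ≤ (2 * A * (σε : ℝ) ^ 2 + 2) * rate p n ∧
        |1 / (n : ℝ) * ∑ i ∈ Finset.univ.filter (fun i => τ < M.w i ω), M.ε i ω * M.x i ω j|
          ≤ 2 * ((2 * A * (σε : ℝ) ^ 2 + 2) * rate p n)}
      ≤ ENNReal.ofReal (2 * Real.exp (-Real.log p)) := by
  have hn0 : (0 : ℝ) < n := by exact_mod_cast hn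
  have hp0 : (0 : ℝ) < p := by positivity
  have hlog : 0 < Real.log p := Real.log_pos (by exact_mod_cast hp)
  have hrate : 0 < rate p n := Real.sqrt_pos.2 (by positivity)
  have hnr : n * rate p n ^ 2 = Real.log p := by rw [rate_sq]; field_simp
  -- With `θ = rate p n`, so that `n θ² = log p`, the exponent is `-(c - 2Aσε²) log p = -2 log p`.
  set c := 2 * A * (σε : ℝ) ^ 2 + 2 with hc
  have hc0 : 0 < c := by positivity
  let sg : Bool → ℝ := fun b => if b then 1 else -1
  have hsg : ∀ b, sg b ^ 2 = 1 := fun b => by cases b <;> simp [sg]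
  set E : Fin p × Bool → Set M.Ω := fun q =>
    {ω | ∃ τ : ℝ, n * (c * rate p n)
      ≤ ∑ i, if M.w i ω ≤ τ then sg q.2 * (M.x i ω q.1 * M.ε i ω) else 0} with hE
  have hEle : ∀ q, M.P (E q) ≤ ENNReal.ofReal (Real.exp (-(2 * Real.log p))) := by
    rintro ⟨j, b⟩
    have mxj : ∀ i, Measurable fun ω => M.x i ω j := fun i =>
      (measurable_pi_apply j).comp (M.measurable_x i)
    have hxε : ∀ i, IndepFun (fun ω => M.x i ω j) (M.ε i) M.P := fun i =>
      (h.indepFun_x_ε i).comp (measurable_pi_apply j) measurable_id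
    have hθ : ∀ i ω, rate p n * (sg b * (M.x i ω j * M.ε i ω))
        = (rate p n * sg b) * (M.x i ω j * M.ε i ω) := fun i ω => by ring
    have hsq : (rate p n * sg b) ^ 2 = rate p n ^ 2 := by rw [mul_pow, hsg, mul_one]
    have key := measure_exists_le_sum_le M.measurable_w
      (Z := fun i ω => sg b * (M.x i ω j * M.ε i ω))
      (fun i => ((mxj i).mul (M.measurable_ε i)).const_mul _)
      (h.indep_obs.comp (fun _ z => (z.2.1, sg b * (z.1 j * z.2.2))) fun _ => by fun_prop)
      (fun i => ((h.indep_x i).prodMk_swap (M.measurable_x i) (M.measurable_w i)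
        (M.measurable_ε i) (h.indep_w i)).comp (φ := id)
        (ψ := fun z : (Fin p → ℝ) × ℝ => sg b * (z.1 j * z.2)) measurable_id (by fun_prop))
      hrate.le (r := 2 * A * (σε : ℝ) ^ 2 * rate p n ^ 2)
      (fun i => by
        simp_rw [hθ]
        refine one_le_lintegral_exp_of_integral_eq_zero
          ((hxε i).integrable_mul (h.hasSubgaussianMGF_x_apply i j).integrable
            (h.ε_subgaussian i).integrable) ?_ _
        have := (hxε i).integral_mul_eq_mul_integral (mxj i).aestronglyMeasurable
          (M.measurable_ε i).aestronglyMeasurable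
        rw [h.x_mean, zero_mul] at this
        exact this)
      (fun i => by
        simp_rw [hθ]
        rw [← hsq]
        exact lintegral_exp_mul_indep_le (h.hasSubgaussianMGF_x_apply i j) (h.ε_subgaussian i)
          (mxj i) (M.measurable_ε i) (hxε i) hA (by simpa using hσ) (by simp) (by rwa [hsq]))
      (t := n * (c * rate p n)) (by positivity)
    refine key.trans (ENNReal.ofReal_le_ofReal (Real.exp_le_exp.2 (le_of_eq ?_)))
    rw [← hnr, hc]; ring
  have hsub : {ω | ¬ ∀ (τ : ℝ) (j : Fin p),
        |1 / (n : ℝ) * ∑ i ∈ Finset.univ.filter (fun i => M.w i ω ≤ τ), M.ε i ω * M.x i ω j|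
          ≤ c * rate p n ∧
        |1 / (n : ℝ) * ∑ i ∈ Finset.univ.filter (fun i => τ < M.w i ω), M.ε i ω * M.x i ω j|
          ≤ 2 * (c * rate p n)} ⊆ ⋃ q, E q := by
    intro ω hω
    by_contra hno
    simp only [Set.mem_iUnion, not_exists, hE, Set.mem_ofPred_eq, not_le] at hno
    have hle : ∀ (τ : ℝ) (j : Fin p),
        |1 / (n : ℝ) * ∑ i ∈ Finset.univ.filter (fun i => M.w i ω ≤ τ), M.ε i ω * M.x i ω j|
          ≤ c * rate p n := by
      intro τ j
      have h1 := hno (j, true) τ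
      have h2 := hno (j, false) τ
      have e : ∀ b, (∑ i, if M.w i ω ≤ τ then sg b * (M.x i ω j * M.ε i ω) else 0)
          = sg b * ∑ i ∈ Finset.univ.filter (fun i => M.w i ω ≤ τ), M.ε i ω * M.x i ω j := by
        intro b
        rw [Finset.sum_filter, Finset.mul_sum]
        refine Finset.sum_congr rfl fun i _ => ?_
        split_ifs <;> ring
      rw [e] at h1 h2
      simp only [sg, if_true, Bool.false_eq_true, if_false] at h1 h2
      rw [abs_mul, abs_of_nonneg (by positivity), one_div, ← div_eq_inv_mul, div_le_iff₀ hn0,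
        abs_le]
      constructor <;> linarith
    refine hω fun τ j => ⟨hle τ j, ?_⟩
    -- A threshold above all observations turns the left bound into one for the full sum. The right
    -- sum is the full sum minus a left sum, hence the factor `2`.
    obtain ⟨T, hT⟩ := (Set.finite_range fun i => M.w i ω).bddAbove
    have hall : Finset.univ.filter (fun i => M.w i ω ≤ T) = Finset.univ :=
      Finset.filter_true_of_mem fun i _ => hT ⟨i, rfl⟩
    have hsplit := Finset.sum_filter_add_sum_filter_not Finset.univ (fun i => M.w i ω ≤ τ)
      fun i => M.ε i ω * M.x i ω j
    simp only [not_le] at hsplit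
    have h1 := hle T j
    rw [hall, ← hsplit, mul_add] at h1
    have h2 := hle τ j
    rw [abs_le] at h1 h2 ⊢
    constructor <;> linarith
  refine (measure_mono hsub).trans ((measure_iUnion_fintype_le _ _).trans
      ((Finset.sum_le_sum fun f _ => hEle f).trans ?_))
  rw [Finset.sum_const, nsmul_eq_mul, Finset.card_univ, Fintype.card_prod, Fintype.card_fin,
    Fintype.card_bool, ← ENNReal.ofReal_natCast, ← ENNReal.ofReal_mul (Nat.cast_nonneg _)]
  refine ENNReal.ofReal_le_ofReal (le_of_eq ?_)
  have : (p : ℝ) * Real.exp (-(2 * Real.log p)) = Real.exp (-Real.log p) := by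
    nth_rw 1 [← Real.exp_log hp0]
    rw [← Real.exp_add]
    congr 1; ring
  push_cast
  linarith

/-- The window event with a bound in terms of the rate of the estimators. -/
theorem Distribution.measure_not_window_le_max (h : M.Distribution σx σε κ φ) {A : ℝ} (hA : 0 < A)
    (hσ : (σx : ℝ) ^ 2 ≤ A) (hp : 1 ≤ p) (hn : 1 ≤ n) {J : Set ℝ} (mJ : MeasurableSet J) {t L : ℝ}
    (ht : 0 ≤ t) (hL : 0 ≤ L) (hJ : M.lawW.real J ≤ t)
    (hcase : t = 0 ∨ Real.log p / n ≤ L * t ∨ M.ξ * rate p n ≤ L) :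
    M.P {ω | ¬ ∀ j, 1 / (n : ℝ) * ∑ i, J.indicator (fun _ => (1 : ℝ)) (M.w i ω) *
          (|M.x i ω j| * |M.x i ω ⬝ᵥ (M.β₀ - M.γ₀)|)
          ≤ 4 * A * (1 + 2 * L) * max (rate p n) (M.ξ * t)}
      ≤ ENNReal.ofReal (Real.exp (-Real.log p)) := by
  have hξ : 0 ≤ M.ξ := lqNorm_two_nonneg _
  have hmax : 0 ≤ max (rate p n) (M.ξ * t) := (rate_nonneg p n).trans (le_max_left _ _)
  -- When `t = 0` the term `ξ log p / n` may be too large to absorb, but the window is null and the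
  -- sum vanishes almost surely.
  rcases hcase with h0 | hcase
  · have hnull : M.lawW J = 0 := by
      rw [h0] at hJ
      exact (measureReal_eq_zero_iff).1 (le_antisymm hJ measureReal_nonneg)
    have hi : ∀ i, ∀ᵐ ω ∂M.P, M.w i ω ∉ J := by
      intro i
      rw [ae_iff]
      simp only [not_not]
      rw [← h.w_law i, Measure.map_apply (M.measurable_w i) mJ] at hnull
      exact hnull
    have hae : ∀ᵐ ω ∂M.P, ∀ i, M.w i ω ∉ J := ae_all_iff.2 hi
    refine le_trans (le_of_eq (measure_mono_null ?_ (ae_iff.1 hae))) zero_le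
    intro ω hω hall
    refine hω fun j => ?_
    simp only [Set.indicator_of_notMem (hall _), zero_mul, Finset.sum_const_zero, mul_zero]
    positivity
  · refine le_trans (measure_mono ?_) (h.measure_not_window_le hA hσ hp hn mJ hJ (M.β₀ - M.γ₀))
    intro ω hω hall
    refine hω fun j => (hall j).trans ?_
    change 4 * A * M.ξ * (t + 2 * (Real.log p / n)) ≤ _
    have key : M.ξ * (t + 2 * (Real.log p / n)) ≤ (1 + 2 * L) * max (rate p n) (M.ξ * t) := by
      have h1 : M.ξ * t ≤ max (rate p n) (M.ξ * t) := le_max_right _ _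
      have h2 : rate p n ≤ max (rate p n) (M.ξ * t) := le_max_left _ _
      have h3 : M.ξ * (Real.log p / n) ≤ L * max (rate p n) (M.ξ * t) := by
        rcases hcase with hc | hc
        · calc M.ξ * (Real.log p / n) ≤ M.ξ * (L * t) := by gcongr
            _ = L * (M.ξ * t) := by ring
            _ ≤ _ := by gcongr
        · calc M.ξ * (Real.log p / n) = M.ξ * rate p n * rate p n := by rw [← rate_sq]; ring
            _ ≤ L * max (rate p n) (M.ξ * t) :=
              mul_le_mul hc h2 (rate_nonneg p n) hL
      linarith
    calc 4 * A * M.ξ * (t + 2 * (Real.log p / n)) = 4 * A * (M.ξ * (t + 2 * (Real.log p / n))) := by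
          ring
      _ ≤ 4 * A * ((1 + 2 * L) * max (rate p n) (M.ξ * t)) := by gcongr
      _ = _ := by ring

/-- The error of the Lasso on a subset `I` of the observations, given the noise level, the
misspecification bias coming from a window `J`, and the restricted eigenvalue condition. -/
theorem lqNorm_sub_le_of_good {ω : M.Ω} {I : Finset (Fin n)} {J S : Set ℝ} {b b₀ δ : Fin p → ℝ}
    {l κ' F C R c W : ℝ} {s : ℕ}
    (hmin : IsMinOn (fun b : Fin p → ℝ => 1 / (n : ℝ) * ∑ i ∈ I,
      (M.y i ω - M.x i ω ⬝ᵥ b) ^ 2 + l * lqNorm 1 b) Set.univ b)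
    (hres : ∀ i ∈ I, |M.y i ω - M.x i ω ⬝ᵥ b₀ - M.ε i ω|
      ≤ J.indicator (fun _ => (1 : ℝ)) (M.w i ω) * |M.x i ω ⬝ᵥ δ|)
    (hnoise : ∀ j, |1 / (n : ℝ) * ∑ i ∈ I, M.ε i ω * M.x i ω j| ≤ c)
    (hwin : ∀ j, 1 / (n : ℝ) * ∑ i, J.indicator (fun _ => (1 : ℝ)) (M.w i ω) *
          (|M.x i ω j| * |M.x i ω ⬝ᵥ δ|) ≤ W)
    (hRE : ∀ v : Fin p → ℝ, (∑ j, |v j|) ^ 2 ≤ 16 * s * ∑ j, v j ^ 2 →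
        M.lawW.real S * (κ' / 8) * ∑ j, v j ^ 2
          ≤ 1 / (n : ℝ) * ∑ i, S.indicator (fun _ => (1 : ℝ)) (M.w i ω) * (M.x i ω ⬝ᵥ v) ^ 2)
    (hSI : ∀ i, M.w i ω ∈ S → i ∈ I) (hs : {j | b₀ j ≠ 0}.ncard ≤ s)
    (hl : 0 < l) (hcl : c + W ≤ l / 4) (hlR : l ≤ C * R) (hF : 0 < F)
    (hFS : F / 2 ≤ M.lawW.real S) (hκ' : 0 < κ') {q : ℕ} (hq : q = 1 ∨ q = 2) :
    lqNorm q (b - b₀) ≤ 128 * C / κ' * F⁻¹ * (s : ℝ) ^ (1 / (q : ℝ)) * R := by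
  have ha : 0 < F / 2 * (κ' / 8) := by positivity
  have key := lqNorm_lasso_sub_le (c := 1 / (n : ℝ)) (a := F / 2 * (κ' / 8)) (b := b) (b₀ := b₀)
    (I := I) (x := fun i => M.x i ω) (y := fun i => M.y i ω) (s := s) (by positivity) hl ha
    (hmin (Set.mem_univ b₀)) ?_ hs ?_ hq
  · refine key.trans ?_
    have hs0 : 0 ≤ (s : ℝ) ^ (1 / (q : ℝ)) := by positivity
    calc 8 * (l / (F / 2 * (κ' / 8))) * (s : ℝ) ^ (1 / (q : ℝ))
        ≤ 8 * (C * R / (F / 2 * (κ' / 8))) * (s : ℝ) ^ (1 / (q : ℝ)) := by gcongr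
      _ = _ := by field_simp; ring
  · intro j
    refine le_trans ?_ hcl
    have h1 : 1 / (n : ℝ) * ∑ i ∈ I, (M.y i ω - M.x i ω ⬝ᵥ b₀) * M.x i ω j
        = 1 / (n : ℝ) * ∑ i ∈ I, M.ε i ω * M.x i ω j
          + 1 / (n : ℝ) * ∑ i ∈ I, (M.y i ω - M.x i ω ⬝ᵥ b₀ - M.ε i ω) * M.x i ω j := by
      rw [← mul_add, ← Finset.sum_add_distrib]
      congr 1
      exact Finset.sum_congr rfl fun i _ => by ring
    rw [h1]
    -- The bias is bounded termwise in absolute value, so the sum over `I` extends to the whole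
    -- window, which does not depend on `τ`.
    refine (abs_add_le _ _).trans (add_le_add (hnoise j) (le_trans ?_ (hwin j)))
    rw [abs_mul, abs_of_nonneg (by positivity)]
    gcongr
    calc |∑ i ∈ I, (M.y i ω - M.x i ω ⬝ᵥ b₀ - M.ε i ω) * M.x i ω j|
        ≤ ∑ i ∈ I, |(M.y i ω - M.x i ω ⬝ᵥ b₀ - M.ε i ω) * M.x i ω j| :=
          Finset.abs_sum_le_sum_abs _ _
      _ ≤ ∑ i ∈ I, J.indicator (fun _ => (1 : ℝ)) (M.w i ω) *
          (|M.x i ω j| * |M.x i ω ⬝ᵥ δ|) := by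
          refine Finset.sum_le_sum fun i hi => ?_
          rw [abs_mul]
          calc _ ≤ J.indicator (fun _ => (1 : ℝ)) (M.w i ω) * |M.x i ω ⬝ᵥ δ| * |M.x i ω j| :=
                mul_le_mul_of_nonneg_right (hres i hi) (abs_nonneg _)
            _ = _ := by ring
      _ ≤ _ := by
          refine Finset.sum_le_univ_sum_of_nonneg fun i => ?_
          have : 0 ≤ J.indicator (fun _ => (1 : ℝ)) (M.w i ω) :=
            Set.indicator_nonneg (fun _ _ => zero_le_one) _
          positivity
  · intro v hv
    calc F / 2 * (κ' / 8) * ∑ j, v j ^ 2 ≤ M.lawW.real S * (κ' / 8) * ∑ j, v j ^ 2 := by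
          have : 0 ≤ ∑ j, v j ^ 2 := Finset.sum_nonneg fun _ _ => sq_nonneg _
          gcongr
      _ ≤ _ := hRE v hv
      _ ≤ 1 / (n : ℝ) * ∑ i ∈ I, (M.x i ω ⬝ᵥ v) ^ 2 := by
          gcongr
          classical
          rw [← Finset.sum_filter_add_sum_filter_not Finset.univ (fun i => i ∈ I)]
          have h2 : ∑ i ∈ Finset.univ.filter (fun i => ¬ i ∈ I),
              S.indicator (fun _ => (1 : ℝ)) (M.w i ω) * (M.x i ω ⬝ᵥ v) ^ 2 = 0 := by
            refine Finset.sum_eq_zero fun i hi => ?_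
            rw [Set.indicator_of_notMem fun hS => (Finset.mem_filter.1 hi).2 (hSI i hS), zero_mul]
          rw [h2, add_zero, Finset.filter_univ_mem]
          refine Finset.sum_le_sum fun i _ => ?_
          have : S.indicator (fun _ => (1 : ℝ)) (M.w i ω) ≤ 1 :=
            Set.indicator_le_self' (fun _ _ => zero_le_one) _
          nlinarith [sq_nonneg (M.x i ω ⬝ᵥ v)]

end ChangePointModel

/-! ### Windows swept out by the admissible thresholds. -/

section Window

variable {ν : Measure ℝ} [IsProbabilityMeasure ν] {t₀ r : ℝ} {T : Set ℝ}

theorem measurableSet_exists_mem_le (T : Set ℝ) : MeasurableSet {w : ℝ | ∃ τ ∈ T, w ≤ τ} :=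
  IsLowerSet.ordConnected (s := {w : ℝ | ∃ τ ∈ T, w ≤ τ})
    (fun _ _ hab ⟨τ, hτ, h⟩ => ⟨τ, hτ, hab.trans h⟩) |>.measurableSet

theorem measurableSet_exists_mem_lt (T : Set ℝ) : MeasurableSet {w : ℝ | ∃ τ ∈ T, τ < w} :=
  IsUpperSet.ordConnected (s := {w : ℝ | ∃ τ ∈ T, τ < w})
    (fun _ _ hab ⟨τ, hτ, h⟩ => ⟨τ, hτ, h.trans_le hab⟩) |>.measurableSet

/-- Inner regularity. A set of thresholds need not have extreme elements, but a compact subset of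
the window does. -/
theorem measureReal_le_of_forall_isCompact {S : Set ℝ} (mS : MeasurableSet S) (hr : 0 ≤ r)
    (h : ∀ K ⊆ S, IsCompact K → K.Nonempty → ν.real K ≤ r) : ν.real S ≤ r := by
  by_contra hlt
  have hlt' : ENNReal.ofReal r < ν S := by
    rw [← ofReal_measureReal (μ := ν)]
    exact (ENNReal.ofReal_lt_ofReal_iff (hr.trans_lt (not_le.1 hlt))).2 (not_le.1 hlt)
  obtain ⟨K, hKS, hK, hrK⟩ := mS.exists_lt_isCompact hlt'
  have hne : K.Nonempty := by
    rw [Set.nonempty_iff_ne_empty]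
    rintro rfl
    simp at hrK
  have h1 := h K hKS hK hne
  rw [← ofReal_measureReal (μ := ν)] at hrK
  exact absurd (ENNReal.ofReal_le_ofReal h1) (not_le.2 hrK)

/-- The largest point of a compact subset lies below a single `τ ∈ T`, so the subset is contained in
`(t₀, τ]`. Continuity of the distribution function is not needed. -/
theorem measureReal_window_right_le (hr : 0 ≤ r)
    (hT : ∀ τ ∈ T, |ν.real (Set.Iic τ) - ν.real (Set.Iic t₀)| ≤ r) :
    ν.real (Set.Ioi t₀ ∩ {w | ∃ τ ∈ T, w ≤ τ}) ≤ r := by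
  refine measureReal_le_of_forall_isCompact
    (measurableSet_Ioi.inter (measurableSet_exists_mem_le T)) hr fun K hKS hK hne => ?_
  obtain ⟨m, hm, hmax⟩ := hK.exists_isGreatest hne
  obtain ⟨hm0, τ, hτ, hmτ⟩ := hKS hm
  have hsub : K ⊆ Set.Iic τ \ Set.Iic t₀ := fun w hw =>
    ⟨(hmax hw).trans hmτ, fun hle => (Set.mem_Ioi.1 (hKS hw).1).not_ge hle⟩
  refine (measureReal_mono hsub).trans ?_
  rw [measureReal_sdiff (Set.Iic_subset_Iic.2 ((Set.mem_Ioi.1 hm0).le.trans hmτ))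
    measurableSet_Iic]
  exact (le_abs_self _).trans (hT τ hτ)

theorem measureReal_window_left_le (hr : 0 ≤ r)
    (hT : ∀ τ ∈ T, |ν.real (Set.Iic τ) - ν.real (Set.Iic t₀)| ≤ r) :
    ν.real (Set.Iic t₀ ∩ {w | ∃ τ ∈ T, τ < w}) ≤ r := by
  refine measureReal_le_of_forall_isCompact
    (measurableSet_Iic.inter (measurableSet_exists_mem_lt T)) hr fun K hKS hK hne => ?_
  obtain ⟨m, hm, hmin⟩ := hK.exists_isLeast hne
  obtain ⟨hm0, τ, hτ, hmτ⟩ := hKS hm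
  have hsub : K ⊆ Set.Iic t₀ \ Set.Iic τ := fun w hw =>
    ⟨(hKS hw).1, not_le.2 (hmτ.trans_le (hmin hw))⟩
  refine (measureReal_mono hsub).trans ?_
  rw [measureReal_sdiff (Set.Iic_subset_Iic.2 (hmτ.le.trans hm0)) measurableSet_Iic]
  have := hT τ hτ
  rw [abs_sub_comm] at this
  exact (le_abs_self _).trans this

/-- The complement consists of the `w` lying in every left partition. It misses only the left window
from `Iic t₀`, and it carries the restricted eigenvalue condition for all `τ` at once. -/
theorem le_measureReal_forall_mem_le (hr : 0 ≤ r)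
    (hT : ∀ τ ∈ T, |ν.real (Set.Iic τ) - ν.real (Set.Iic t₀)| ≤ r) :
    ν.real (Set.Iic t₀) - r ≤ ν.real {w | ∃ τ ∈ T, τ < w}ᶜ := by
  have hsub : Set.Iic t₀ ⊆ {w | ∃ τ ∈ T, τ < w}ᶜ ∪ (Set.Iic t₀ ∩ {w | ∃ τ ∈ T, τ < w}) := by
    intro w hw
    by_cases h : w ∈ {w | ∃ τ ∈ T, τ < w}
    · exact Or.inr ⟨hw, h⟩
    · exact Or.inl h
  have := (measureReal_mono hsub (μ := ν)).trans (measureReal_union_le _ _)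
  linarith [measureReal_window_left_le hr hT]

theorem le_measureReal_forall_mem_lt (hr : 0 ≤ r)
    (hT : ∀ τ ∈ T, |ν.real (Set.Iic τ) - ν.real (Set.Iic t₀)| ≤ r) :
    1 - ν.real (Set.Iic t₀) - r ≤ ν.real {w | ∃ τ ∈ T, w ≤ τ}ᶜ := by
  have hsub : Set.Ioi t₀ ⊆ {w | ∃ τ ∈ T, w ≤ τ}ᶜ ∪ (Set.Ioi t₀ ∩ {w | ∃ τ ∈ T, w ≤ τ}) := by
    intro w hw
    by_cases h : w ∈ {w | ∃ τ ∈ T, w ≤ τ}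
    · exact Or.inr ⟨hw, h⟩
    · exact Or.inl h
  have := (measureReal_mono hsub (μ := ν)).trans (measureReal_union_le _ _)
  rw [← Set.compl_Iic, measureReal_compl measurableSet_Iic, probReal_univ, Set.compl_Iic] at this
  linarith [measureReal_window_right_le hr hT]

end Window

/-! ### Assembling the events for fixed sample size. -/

namespace ChangePointModel

variable {n p : ℕ} {M : ChangePointModel.{u} n p} {σx σε : ℝ≥0} {κ φ : ℝ}

theorem Φ_coe (M : ChangePointModel.{u} n p) (τ : ℝ) : M.Φ τ = M.lawW.real (Set.Iic τ) :=
  cdf_eq_real M.lawW τ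

theorem HoldsWithProb.mono {δ δ' : ℝ} {g g' : M.Ω → Prop} (h : M.HoldsWithProb δ g) (hδ : δ ≤ δ')
    (hg : ∀ ω, g ω → g' ω) : M.HoldsWithProb δ' g' := by
  refine le_trans (measure_mono ?_) (h.trans (ENNReal.ofReal_le_ofReal hδ))
  exact fun ω hω hgω => hω (hg ω hgω)

theorem HoldsWithProb.and {δ δ' : ℝ} {g g' : M.Ω → Prop} (h : M.HoldsWithProb δ g)
    (h' : M.HoldsWithProb δ' g') (hδ : 0 ≤ δ) (hδ' : 0 ≤ δ') :
    M.HoldsWithProb (δ + δ') fun ω => g ω ∧ g' ω := by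
  unfold HoldsWithProb
  rw [ENNReal.ofReal_add hδ hδ']
  refine le_trans (measure_mono ?_) ((measure_union_le _ _).trans (add_le_add h h'))
  intro ω hω
  exact not_and_or.1 hω

theorem holdsWithProb_of_one_le {δ : ℝ} (hδ : 1 ≤ δ) (g : M.Ω → Prop) : M.HoldsWithProb δ g :=
  prob_le_one.trans (ENNReal.one_le_ofReal.2 hδ)

theorem Sparse.ncard_β₀_le {s : ℕ} (h : M.Sparse s) : {j | M.β₀ j ≠ 0}.ncard ≤ s :=
  (Set.ncard_le_ncard (fun _ hj => Or.inl hj) (Set.toFinite _)).trans h.2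

theorem Sparse.ncard_γ₀_le {s : ℕ} (h : M.Sparse s) : {j | M.γ₀ j ≠ 0}.ncard ≤ s :=
  (Set.ncard_le_ncard (fun _ hj => Or.inr hj) (Set.toFinite _)).trans h.2

/-- A real `τ₀` with no mass of `w` at or below it also counts as no change; the observations before
it form a null event. -/
theorem Distribution.holdsWithProb_no_observation_before (h : M.Distribution σx σε κ φ)
    (h0 : M.Φ M.τ₀ = 0) :
    M.HoldsWithProb 0 fun ω => ∀ i, ¬ ((M.w i ω : ℝ) : WithBot ℝ) ≤ M.τ₀ := by
  unfold HoldsWithProb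
  rw [ENNReal.ofReal_zero, nonpos_iff_eq_zero]
  refine ae_iff.1 (ae_all_iff.2 fun i => ?_)
  cases hτ : M.τ₀ with
  | bot => exact ae_of_all _ fun ω => by simp
  | coe t =>
    rw [hτ, Φ_coe] at h0
    rw [ae_iff]
    simp only [not_not, WithBot.coe_le_coe]
    have := (measureReal_eq_zero_iff).1 h0
    rw [← h.w_law i, Measure.map_apply (M.measurable_w i) measurableSet_Iic] at this
    exact this

/-- The estimators in the absence of a change point, for fixed `n`. -/
theorem Distribution.holdsWithProb_no_change (h : M.Distribution σx σε κ φ) {A κ' : ℝ}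
    (hκ' : 0 < κ') (hκ : κ' ≤ κ) (hκA : κ' ≤ A) (hσ : (σx : ℝ) ^ 2 ≤ A) (hp : 2 ≤ p) (hn : 1 ≤ n)
    {s : ℕ} (hs : M.Sparse s) {K : ℕ} (hK : 1024 * A / κ' ≤ K)
    (hr : 2 * A * (σε : ℝ) ^ 2 * rate p n ^ 2 ≤ 1) {τ : ℝ} (hF : 0 < M.Φmin τ)
    (h0 : M.Φ M.τ₀ = 0)
    (hsn : (2 * K + 3) * (s * Real.log p) ≤ κ' ^ 2 / (256 * A ^ 2) * (n * (M.Φmin τ / 2)))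
    {l C : ℝ} (hl : 8 * (2 * A * (σε : ℝ) ^ 2 + 2) * rate p n ≤ l) (hlC : l ≤ C * rate p n) :
    M.HoldsWithProb (6 * Real.exp (-Real.log p)) fun ω => ∀ q : ℕ, q = 1 ∨ q = 2 →
      (∀ b, M.IsLassoBeta l τ ω b → lqNorm q (b - M.γ₀) ≤
        128 * C / κ' * (M.Φmin τ)⁻¹ * (s : ℝ) ^ (1 / (q : ℝ)) * rate p n) ∧
      (∀ g, M.IsLassoGamma l τ ω g → lqNorm q (g - M.γ₀) ≤
        128 * C / κ' * (M.Φmin τ)⁻¹ * (s : ℝ) ^ (1 / (q : ℝ)) * rate p n) := by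
  have hA : 0 < A := hκ'.trans_le hκA
  have hrate : 0 < rate p n := by
    have : 0 < Real.log p := Real.log_pos (by exact_mod_cast hp)
    have hn0 : (0 : ℝ) < n := by exact_mod_cast hn
    exact Real.sqrt_pos.2 (by positivity)
  have hl0 : 0 < l := lt_of_lt_of_le (by positivity) hl
  have hS : M.Φmin τ ≤ M.lawW.real (Set.Iic τ) := by
    rw [← Φ_coe]; exact min_le_left _ _
  have hS' : M.Φmin τ ≤ M.lawW.real (Set.Ioi τ) := by
    rw [← Set.compl_Iic, measureReal_compl measurableSet_Iic, probReal_univ, ← Φ_coe]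
    exact min_le_right _ _
  have hsn' : ∀ S : Set ℝ, M.Φmin τ ≤ M.lawW.real S → (2 * K + 3) * (s * Real.log p)
      ≤ κ' ^ 2 / (256 * A ^ 2) * (n * M.lawW.real S) := by
    intro S hS
    refine hsn.trans ?_
    gcongr
    linarith
  have hRE : M.HoldsWithProb _ _ := h.measure_not_restricted_eigenvalue_le hκ' hκ hκA hσ hp hs.1 hK
    measurableSet_Iic (hsn' _ hS)
  have hRE' : M.HoldsWithProb _ _ := h.measure_not_restricted_eigenvalue_le hκ' hκ hκA hσ hp hs.1 hK
    measurableSet_Ioi (hsn' _ hS')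
  have hnoise : M.HoldsWithProb _ _ := h.measure_not_noise_le hA hσ hp hn hr
  have hall := (((h.holdsWithProb_no_observation_before h0).and hnoise le_rfl (by positivity)).and
    hRE (by positivity) (by positivity)).and hRE' (by positivity) (by positivity)
  refine hall.mono (by linarith) ?_
  rintro ω ⟨⟨⟨hw, hno⟩, hre⟩, hre'⟩ q hq
  -- Without a change there is no bias: empty window and `δ = 0`.
  have hy : ∀ i, |M.y i ω - M.x i ω ⬝ᵥ M.γ₀ - M.ε i ω|
      ≤ (∅ : Set ℝ).indicator (fun _ => (1 : ℝ)) (M.w i ω) * |M.x i ω ⬝ᵥ (0 : Fin p → ℝ)| := by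
    intro i
    simp [y, hw i]
  have hc0 : 0 ≤ (2 * A * (σε : ℝ) ^ 2 + 2) * rate p n := by positivity
  constructor
  · intro b hb
    exact lqNorm_sub_le_of_good (c := (2 * A * (σε : ℝ) ^ 2 + 2) * rate p n) (W := 0) hb
      (fun i _ => hy i) (fun j => (hno τ j).1)
      (fun j => by simp) hre (fun i hi => by simpa using hi) hs.ncard_γ₀_le hl0
      (by linarith) hlC hF (by linarith) hκ' hq
  · intro g hg
    exact lqNorm_sub_le_of_good (c := 2 * ((2 * A * (σε : ℝ) ^ 2 + 2) * rate p n)) (W := 0) hg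
      (fun i _ => hy i) (fun j => (hno τ j).2)
      (fun j => by simp) hre' (fun i hi => by simpa using hi) hs.ncard_γ₀_le hl0
      (by linarith) hlC hF (by linarith) hκ' hq

/-- The estimators near a finite change point, for fixed `n`. -/
theorem Distribution.holdsWithProb_change_point (h : M.Distribution σx σε κ φ) {A κ' : ℝ}
    (hκ' : 0 < κ') (hκ : κ' ≤ κ) (hκA : κ' ≤ A) (hσ : (σx : ℝ) ^ 2 ≤ A) (hp : 2 ≤ p) (hn : 1 ≤ n)
    {s : ℕ} (hs : M.Sparse s) {K : ℕ} (hK : 1024 * A / κ' ≤ K)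
    (hr : 2 * A * (σε : ℝ) ^ 2 * rate p n ^ 2 ≤ 1) (hF : 0 < M.Φmin M.τ₀)
    (hsn : (2 * K + 3) * (s * Real.log p) ≤ κ' ^ 2 / (256 * A ^ 2) * (n * (M.Φmin M.τ₀ / 2)))
    {r L : ℝ} (hr0 : 0 ≤ r) (hrF : r ≤ M.Φmin M.τ₀ / 2) (hL : 0 ≤ L)
    (hcase : r = 0 ∨ Real.log p / n ≤ L * r ∨ M.ξ * rate p n ≤ L)
    {l C : ℝ} (hC : 8 * (2 * A * (σε : ℝ) ^ 2 + 2) + 16 * A * (1 + 2 * L) ≤ C)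
    (hl : l = C * max (rate p n) (M.ξ * r)) :
    M.HoldsWithProb (8 * Real.exp (-Real.log p)) fun ω => ∀ q : ℕ, q = 1 ∨ q = 2 →
      ∀ τ ∈ M.nbhd r,
      (∀ b, M.IsLassoBeta l τ ω b → lqNorm q (b - M.β₀) ≤
        128 * C / κ' * (M.Φmin M.τ₀)⁻¹ * (s : ℝ) ^ (1 / (q : ℝ)) * max (rate p n) (M.ξ * r)) ∧
      (∀ g, M.IsLassoGamma l τ ω g → lqNorm q (g - M.γ₀) ≤
        128 * C / κ' * (M.Φmin M.τ₀)⁻¹ * (s : ℝ) ^ (1 / (q : ℝ)) *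
          max (rate p n) (M.ξ * r)) := by
  have hA : 0 < A := hκ'.trans_le hκA
  have hrate : 0 < rate p n := by
    have : 0 < Real.log p := Real.log_pos (by exact_mod_cast hp)
    have hn0 : (0 : ℝ) < n := by exact_mod_cast hn
    exact Real.sqrt_pos.2 (by positivity)
  obtain ⟨t₀, ht₀⟩ : ∃ t₀ : ℝ, M.τ₀ = t₀ := by
    cases hτ : M.τ₀ with
    | bot =>
      rw [hτ] at hF
      exact absurd (hF.trans_le (min_le_left _ _)) (lt_irrefl _)
    | coe t => exact ⟨t, rfl⟩
  have hT : ∀ τ ∈ M.nbhd r, |M.lawW.real (Set.Iic τ) - M.lawW.real (Set.Iic t₀)| ≤ r := by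
    intro τ hτ
    rw [← Φ_coe, ← Φ_coe, ← ht₀]
    exact hτ
  have hF1 : M.Φmin M.τ₀ ≤ M.lawW.real (Set.Iic t₀) := by
    rw [← Φ_coe, ← ht₀]; exact min_le_left _ _
  have hF2 : M.Φmin M.τ₀ ≤ 1 - M.lawW.real (Set.Iic t₀) := by
    rw [← Φ_coe, ← ht₀]; exact min_le_right _ _
  set F := M.Φmin M.τ₀ with hFdef
  set R := max (rate p n) (M.ξ * r) with hR
  have hR0 : 0 < R := hrate.trans_le (le_max_left _ _)
  have hS : F / 2 ≤ M.lawW.real {w | ∃ τ ∈ M.nbhd r, τ < w}ᶜ := by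
    linarith [le_measureReal_forall_mem_le hr0 hT]
  have hS' : F / 2 ≤ M.lawW.real {w | ∃ τ ∈ M.nbhd r, w ≤ τ}ᶜ := by
    linarith [le_measureReal_forall_mem_lt hr0 hT]
  have hsn' : ∀ S : Set ℝ, F / 2 ≤ M.lawW.real S → (2 * K + 3) * (s * Real.log p)
      ≤ κ' ^ 2 / (256 * A ^ 2) * (n * M.lawW.real S) := by
    intro S hS
    refine hsn.trans ?_
    gcongr
  have hRE : M.HoldsWithProb _ _ := h.measure_not_restricted_eigenvalue_le hκ' hκ hκA hσ hp hs.1 hK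
    (measurableSet_exists_mem_lt (M.nbhd r)).compl (hsn' _ hS)
  have hRE' : M.HoldsWithProb _ _ := h.measure_not_restricted_eigenvalue_le hκ' hκ hκA hσ hp hs.1 hK
    (measurableSet_exists_mem_le (M.nbhd r)).compl (hsn' _ hS')
  have hnoise : M.HoldsWithProb _ _ := h.measure_not_noise_le hA hσ hp hn hr
  have hwin : M.HoldsWithProb _ _ := h.measure_not_window_le_max hA hσ (by omega) hn
    (measurableSet_Ioi.inter (measurableSet_exists_mem_le (M.nbhd r))) hr0 hL
    (measureReal_window_right_le hr0 hT) hcase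
  have hwin' : M.HoldsWithProb _ _ := h.measure_not_window_le_max hA hσ (by omega) hn
    (measurableSet_Iic.inter (measurableSet_exists_mem_lt (M.nbhd r))) hr0 hL
    (measureReal_window_left_le hr0 hT) hcase
  have hall := (((hnoise.and hRE (by positivity) (by positivity)).and
    hRE' (by positivity) (by positivity)).and hwin (by positivity) (by positivity)).and hwin'
    (by positivity) (by positivity)
  refine hall.mono (by linarith) ?_
  rintro ω ⟨⟨⟨⟨hno, hre⟩, hre'⟩, hwi⟩, hwi'⟩ q hq τ hτ
  have hc0 : 0 ≤ (2 * A * (σε : ℝ) ^ 2 + 2) * R := by positivity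
  have hcR : (2 * A * (σε : ℝ) ^ 2 + 2) * rate p n ≤ (2 * A * (σε : ℝ) ^ 2 + 2) * R := by
    gcongr
    exact le_max_left _ _
  -- One quarter of this constant covers the doubled noise bound of the right partition plus the
  -- window bias.
  have hCR : (8 * (2 * A * (σε : ℝ) ^ 2 + 2) + 16 * A * (1 + 2 * L)) * R ≤ l := by
    rw [hl]; gcongr
  have hl0 : 0 < l := lt_of_lt_of_le (by positivity) hCR
  have hxδ : ∀ i, M.x i ω ⬝ᵥ (M.β₀ - M.γ₀) = M.x i ω ⬝ᵥ M.β₀ - M.x i ω ⬝ᵥ M.γ₀ := fun i =>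
    dotProduct_sub _ _ _
  constructor
  · intro b hb
    refine lqNorm_sub_le_of_good (c := (2 * A * (σε : ℝ) ^ 2 + 2) * rate p n)
      (W := 4 * A * (1 + 2 * L) * R) hb (fun i hi => ?_) (fun j => (hno τ j).1)
      hwi hre (fun i hi => ?_) hs.ncard_β₀_le hl0
      (by linarith) hl.le hF hS hκ' hq
    · have hi' : M.w i ω ≤ τ := by simpa using hi
      by_cases hle : M.w i ω ≤ t₀
      · have h1 : M.y i ω - M.x i ω ⬝ᵥ M.β₀ - M.ε i ω = 0 := by
          simp [y, ht₀, WithBot.coe_le_coe, hle]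
        rw [h1, abs_zero]
        exact mul_nonneg (Set.indicator_nonneg (fun _ _ => zero_le_one) _) (abs_nonneg _)
      · rw [Set.indicator_of_mem (show M.w i ω ∈ Set.Ioi t₀ ∩ {w | ∃ τ ∈ M.nbhd r, w ≤ τ} from
          ⟨not_le.1 hle, τ, hτ, hi'⟩), one_mul, hxδ, abs_sub_comm]
        refine le_of_eq ?_
        congr 1
        simp only [y, ht₀, WithBot.coe_le_coe, hle, if_false]
        ring
    · simp only [Finset.mem_filter, Finset.mem_univ, true_and]
      by_contra hlt
      exact hi ⟨τ, hτ, not_le.1 hlt⟩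
  · intro g hg
    refine lqNorm_sub_le_of_good (c := 2 * ((2 * A * (σε : ℝ) ^ 2 + 2) * rate p n))
      (W := 4 * A * (1 + 2 * L) * R) hg (fun i hi => ?_) (fun j => (hno τ j).2)
      hwi' hre' (fun i hi => ?_) hs.ncard_γ₀_le hl0
      (by linarith) hl.le hF hS' hκ' hq
    · have hi' : τ < M.w i ω := by simpa using hi
      by_cases hle : M.w i ω ≤ t₀
      · rw [Set.indicator_of_mem (show M.w i ω ∈ Set.Iic t₀ ∩ {w | ∃ τ ∈ M.nbhd r, τ < w} from
          ⟨hle, τ, hτ, hi'⟩), one_mul, hxδ]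
        refine le_of_eq ?_
        congr 1
        simp only [y, ht₀, WithBot.coe_le_coe, hle, if_true]
        ring
      · have h1 : M.y i ω - M.x i ω ⬝ᵥ M.γ₀ - M.ε i ω = 0 := by
          simp [y, ht₀, WithBot.coe_le_coe, hle]
        rw [h1, abs_zero]
        exact mul_nonneg (Set.indicator_nonneg (fun _ _ => zero_le_one) _) (abs_nonneg _)
    · simp only [Finset.mem_filter, Finset.mem_univ, true_and]
      by_contra hlt
      exact hi ⟨τ, hτ, not_lt.1 hlt⟩

end ChangePointModel

/-! ### Large sample sizes and the theorem. -/

/-- For `p ≤ 1` the logarithm is `0` (with `Real.log 0 = 0`), so the allowed failure probability is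
at least `1` and the claim is vacuous. -/
theorem one_le_mul_exp_neg_log {p : ℕ} (hp : p < 2) {c : ℝ} (hc : 1 ≤ c) :
    1 ≤ c * Real.exp (-1 * Real.log p) := by
  have : Real.log p = 0 := by interval_cases p <;> simp
  simpa [this] using hc

/-- The sample size conditions hold eventually. -/
theorem eventually_sample_size {p s : ℕ → ℕ} {F : ℕ → ℝ} (hs : ∀ n, 1 ≤ s n) (hF : ∀ n, 0 < F n)
    (h1 : Tendsto (fun n : ℕ => s n * Real.log (p n) / n) atTop (𝓝 0))
    (h2 : Tendsto (fun n : ℕ => (F n)⁻¹ * (s n * Real.log (p n) / n)) atTop (𝓝 0))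
    {B c ρ : ℝ} (hB : 0 ≤ B) (hc : 0 < c) (hρ : 0 < ρ) :
    ∀ᶠ n : ℕ in atTop, 1 ≤ n ∧ B * rate (p n) n ^ 2 ≤ 1 ∧
      c * (s n * Real.log (p n)) ≤ ρ * (n * (F n / 2)) := by
  filter_upwards [eventually_ge_atTop 1,
    h1.eventually (Iio_mem_nhds (show (0 : ℝ) < (B + 1)⁻¹ by positivity)),
    h2.eventually (Iio_mem_nhds (show (0 : ℝ) < ρ / (2 * c) by positivity))] with n hn e1 e2
  have hn0 : (0 : ℝ) < n := by exact_mod_cast hn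
  have hlog : 0 ≤ Real.log (p n) := Real.log_natCast_nonneg _
  have hs1 : (1 : ℝ) ≤ s n := by exact_mod_cast hs n
  refine ⟨hn, ?_, ?_⟩
  · rw [rate_sq]
    have h3 : Real.log (p n) / n ≤ (B + 1)⁻¹ := by
      refine le_trans ?_ (le_of_lt e1)
      gcongr
      nlinarith
    calc B * (Real.log (p n) / n) ≤ (B + 1) * (B + 1)⁻¹ := by gcongr; linarith
      _ = 1 := mul_inv_cancel₀ (by positivity)
  · have h3 : (F n)⁻¹ * (s n * Real.log (p n) / n) ≤ ρ / (2 * c) := le_of_lt e2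
    rw [inv_mul_le_iff₀ (hF n), div_le_iff₀ hn0] at h3
    calc c * (s n * Real.log (p n)) ≤ c * (F n * (ρ / (2 * c)) * n) := by gcongr
      _ = _ := by field_simp

theorem theoremt1 (σx σε : ℝ≥0) (κ φ : ℝ) (hκ : 0 < κ) :
    -- (i) no change
    (∃ C₀ c₁ c₂ : ℝ, 0 < C₀ ∧ 0 < c₁ ∧ 0 < c₂ ∧ ∀ C₁ : ℝ, C₀ ≤ C₁ → ∃ K : ℝ, 0 < K ∧
      ∀ (p s : ℕ → ℕ) (M : ∀ n, ChangePointModel.{u} n (p n)) (τ lam : ℕ → ℝ),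
        (∀ n, (M n).Sparse (s n)) →
        Tendsto (fun n : ℕ => s n * Real.log (p n) / n) atTop (𝓝 0) →
        (∀ n, (M n).Distribution σx σε κ φ) →
        (∀ n, 0 < (M n).Φmin (τ n)) →
        Tendsto (fun n : ℕ => ((M n).Φmin (τ n))⁻¹ * (s n * Real.log (p n) / n)) atTop (𝓝 0) →
        (∀ n, (M n).Φ (M n).τ₀ = 0) →
        (∀ n, C₀ * rate (p n) n ≤ lam n ∧ lam n ≤ C₁ * rate (p n) n) →
        ∀ᶠ n : ℕ in atTop, (M n).HoldsWithProb (c₁ * Real.exp (-c₂ * Real.log (p n))) fun ω =>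
          ∀ q : ℕ, q = 1 ∨ q = 2 →
            (∀ b, (M n).IsLassoBeta (lam n) (τ n) ω b →
              lqNorm q (b - (M n).γ₀) ≤
                K * ((M n).Φmin (τ n))⁻¹ * (s n : ℝ) ^ (1 / (q : ℝ)) * rate (p n) n) ∧
            (∀ g, (M n).IsLassoGamma (lam n) (τ n) ω g →
              lqNorm q (g - (M n).γ₀) ≤
                K * ((M n).Φmin (τ n))⁻¹ * (s n : ℝ) ^ (1 / (q : ℝ)) * rate (p n) n)) ∧
    -- (ii) a finite change point
    (∀ L : ℝ, 0 < L →
      ∃ C₀ c₁ c₂ : ℝ, 0 < C₀ ∧ 0 < c₁ ∧ 0 < c₂ ∧ ∀ C : ℝ, C₀ ≤ C → ∃ K : ℝ, 0 < K ∧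
      ∀ (p s : ℕ → ℕ) (M : ∀ n, ChangePointModel.{u} n (p n)) (u lam : ℕ → ℝ),
        (∀ n, (M n).Sparse (s n)) →
        Tendsto (fun n : ℕ => s n * Real.log (p n) / n) atTop (𝓝 0) →
        (∀ n, (M n).Distribution σx σε κ φ) →
        (∀ n, 0 < (M n).Φmin (M n).τ₀) →
        Tendsto (fun n : ℕ => ((M n).Φmin (M n).τ₀)⁻¹ * (s n * Real.log (p n) / n))
          atTop (𝓝 0) →
        (∀ n, 0 ≤ u n) →
        Tendsto (fun n => u n / (M n).Φmin (M n).τ₀) atTop (𝓝 0) →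
        -- the jump may be of larger order than `√(n / log p)` only if `u n` vanishes or is at
        -- least of order `log p / n`
        (∀ n, u n = 0 ∨ Real.log (p n) / n ≤ L * u n ∨ (M n).ξ * rate (p n) n ≤ L) →
        (∀ n, lam n = C * max (rate (p n) n) ((M n).ξ * u n)) →
        ∀ᶠ n : ℕ in atTop, (M n).HoldsWithProb (c₁ * Real.exp (-c₂ * Real.log (p n))) fun ω =>
          ∀ q : ℕ, q = 1 ∨ q = 2 → ∀ τ ∈ (M n).nbhd (u n),
            (∀ b, (M n).IsLassoBeta (lam n) τ ω b →
              lqNorm q (b - (M n).β₀) ≤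
                K * ((M n).Φmin (M n).τ₀)⁻¹ * (s n : ℝ) ^ (1 / (q : ℝ)) *
                  max (rate (p n) n) ((M n).ξ * u n)) ∧
            (∀ g, (M n).IsLassoGamma (lam n) τ ω g →
              lqNorm q (g - (M n).γ₀) ≤
                K * ((M n).Φmin (M n).τ₀)⁻¹ * (s n : ℝ) ^ (1 / (q : ℝ)) *
                  max (rate (p n) n) ((M n).ξ * u n))) := by
  -- The added `1` keeps `A` positive when `σx = 0`; taking `κ' = min κ A` secures `κ' ≤ A` without
  -- comparing `κ` and `σx²`.
  set A : ℝ := (σx : ℝ) ^ 2 + 1 with hA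
  have hA0 : 0 < A := by positivity
  have hσ : (σx : ℝ) ^ 2 ≤ A := by linarith
  set κ' : ℝ := min κ A with hκ'
  have hκ'0 : 0 < κ' := lt_min hκ hA0
  have hκ'κ : κ' ≤ κ := min_le_left _ _
  have hκ'A : κ' ≤ A := min_le_right _ _
  obtain ⟨N, hN⟩ := exists_nat_ge (1024 * A / κ')
  have hB : 0 ≤ 2 * A * (σε : ℝ) ^ 2 := by positivity
  -- The counts `6` and `8` add the event costs in units of `1 / p`: two for the noise and two for
  -- each restricted eigenvalue condition, plus in (ii) one for each window.
  refine ⟨⟨8 * (2 * A * (σε : ℝ) ^ 2 + 2), 6, 1, by positivity, by norm_num, one_pos,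
    fun C₁ hC₁ => ?_⟩, fun L hL => ⟨8 * (2 * A * (σε : ℝ) ^ 2 + 2) + 16 * A * (1 + 2 * L), 8, 1,
    by positivity, by norm_num, one_pos, fun C hC => ?_⟩⟩
  · have hC0 : 0 < C₁ := lt_of_lt_of_le (by positivity) hC₁
    refine ⟨128 * C₁ / κ', by positivity, ?_⟩
    intro p s M τ lam hs h1 hM hF h2 h0 hlam
    filter_upwards [eventually_sample_size (fun n => (hs n).1) hF h1 h2 hB
      (show (0 : ℝ) < 2 * N + 3 by positivity)
      (show 0 < κ' ^ 2 / (256 * A ^ 2) by positivity)] with n hn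
    rcases lt_or_ge (p n) 2 with hp | hp
    · exact ChangePointModel.holdsWithProb_of_one_le (one_le_mul_exp_neg_log hp (by norm_num)) _
    · rw [neg_one_mul]
      exact (hM n).holdsWithProb_no_change hκ'0 hκ'κ hκ'A hσ hp hn.1 (hs n) hN hn.2.1 (hF n) (h0 n)
        hn.2.2 (hlam n).1 (hlam n).2
  · have hC0 : 0 < C := lt_of_lt_of_le (by positivity) hC
    refine ⟨128 * C / κ', by positivity, ?_⟩
    intro p s M r lam hs h1 hM hF h2 hr0 hr hcase hlam
    filter_upwards [eventually_sample_size (fun n => (hs n).1) hF h1 h2 hB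
      (show (0 : ℝ) < 2 * N + 3 by positivity)
      (show 0 < κ' ^ 2 / (256 * A ^ 2) by positivity),
      hr.eventually (Iio_mem_nhds (show (0 : ℝ) < 1 / 2 by norm_num))] with n hn hrn
    rcases lt_or_ge (p n) 2 with hp | hp
    · exact ChangePointModel.holdsWithProb_of_one_le (one_le_mul_exp_neg_log hp (by norm_num)) _
    · rw [neg_one_mul]
      have hrF : r n ≤ (M n).Φmin (M n).τ₀ / 2 := by
        have := le_of_lt hrn
        rw [div_le_iff₀ (hF n)] at this
        linarith
      exact (hM n).holdsWithProb_change_point hκ'0 hκ'κ hκ'A hσ hp hn.1 (hs n) hN hn.2.1 (hF n)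
        hn.2.2 (hr0 n) hrF hL.le (hcase n) hC (hlam n)
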